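/- For integers $k,n,m\ge 2$ let $J(k,n,m)=\langle s,t,u\mid s^k=t^n=u^m=1,\ stu=tus=ust\rangle$. Let $k,b,n,c,m$ be positive integers with $k\ge 2$, $bn\ge 2$, $cm\ge 2$ and $\gcd(n,m)=1$. The $J$-reflection group $H=W_b^c(k,bn,cm)$ is the normal closure of $\{s,t^n,u^m\}$ in $J(k,bn,cm)$. Write $m=qn+r$ with $q\ge 0$ and $0\le r\le n-1$. The braid group $\mathcal B(H)$ is the group with generators $x_1,\dots,x_n,y,z$ and relations, where $\delta=x_1\cdots x_n y$, $$x_1\cdots x_n y z=z x_1\cdots x_n y,$$ $$x_{i+1}\cdots x_n y z\,\delta^{q-1}x_1\cdots x_{i+r}=x_i\cdots x_n y z\,\delta^{q-1}x_1\cdots x_{i+r-1}\qquad(1\le i\le n-r),$$ $$x_{i+1}\cdots x_n y z\,\delta^{q}x_1\cdots x_{i+r-n}=x_i\cdots x_n y z\,\delta^{q}x_1\cdots x_{i+r-n-1}\qquad(n-r+1\le i\le n),$$ together with the relation $y=1$ if $b=1$ and the relation $z=1$ if $c=1$. In $\mathcal B(H)$ put $w=z\delta^q x_1\cdots x_r$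 and $\Delta=w^{\,n-r}(wy)^r$. The natural quotient $\pi:\mathcal B(H)\to H$ is the homomorphism with $\pi(x_i)=t^{i-1}st^{1-i}$ for $1\le i\le n$, $\pi(y)=t^n$ and $\pi(z)=u^m$. Then, for every such $H$: the center of $\mathcal B(H)$ is $\langle\Delta\rangle$, it is isomorphic to $\mathbb Z$, and $\Delta=\delta^m z^n$. Moreover, $\pi$ is surjective, and the image of the center of $\mathcal B(H)$ under $\pi$ is the center of $H$. -/

import Mathlib

namespace JReflection

/-- The three canonical generators of the groups `J(k, n, m)`. -/
inductive JGen
  | s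
  | t
  | u

/-- The relators of `⟨s, t, u ∣ s^k = t^n = u^m = 1, stu = tus = ust⟩`. -/
def jRelators (k n m : ℕ) : Set (FreeGroup JGen) :=
  let s := FreeGroup.of JGen.s
  let t := FreeGroup.of JGen.t
  let u := FreeGroup.of JGen.u
  {s ^ k, t ^ n, u ^ m, (s * t * u) * (t * u * s)⁻¹, (t * u * s) * (u * s * t)⁻¹}

/-- The group `J(k, n, m) = ⟨s, t, u ∣ s^k = t^n = u^m = 1, stu = tus = ust⟩`. -/
abbrev J (k n m : ℕ) : Type := PresentedGroup (jRelators k n m)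

/-- The canonical generator `s` of `J(k, n, m)`. -/
def J.s (k n m : ℕ) : J k n m := PresentedGroup.of JGen.s

/-- The canonical generator `t` of `J(k, n, m)`. -/
def J.t (k n m : ℕ) : J k n m := PresentedGroup.of JGen.t

/-- The canonical generator `u` of `J(k, n, m)`. -/
def J.u (k n m : ℕ) : J k n m := PresentedGroup.of JGen.u

/-- The subgroup of `J(k, n, m)` with parameters `(k', n', m')`:
the normal closure of `s^k'`, `t^n'`, `u^m'` in `J(k, n, m)`. -/
def jSubgroup (k n m k' n' m' : ℕ) : Subgroup (J k n m) :=
  Subgroup.normalClosure {J.s k n m ^ k', J.t k n m ^ n', J.u k n m ^ m'}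

/-- The `J`-reflection group `W_b^c(k, bn, cm)`: the normal closure of `s`, `t^n`, `u^m`
in `J(k, bn, cm)`. -/
abbrev W (k b n c m : ℕ) : Subgroup (J k (b * n) (c * m)) :=
  jSubgroup k (b * n) (c * m) 1 n m

section Words

variable {G : Type*} [Group G] {n : ℕ}

/-- The product `x_1 x_2 ⋯ x_j` of the first `j` terms of the tuple `(x_1, …, x_n)`, for `j ≤ n`.
(The term `x_i` is `x ⟨i - 1, _⟩` in Lean.) -/
def initialProd (x : Fin n → G) (j : ℕ) : G := ((List.ofFn x).take j).prod

/-- The product `x_{i+1} x_{i+2} ⋯ x_n` of the terms after the `i`-th one, for `i ≤ n`. -/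
def finalProd (x : Fin n → G) (i : ℕ) : G := ((List.ofFn x).drop i).prod

/-- `δ = x_1 ⋯ x_n y`. -/
def deltaWord (x : Fin n → G) (y : G) : G := initialProd x n * y

/-- `w = z δ^q x_1 ⋯ x_r`, where `m = q n + r` with `0 ≤ r < n`. -/
def wWord (m : ℕ) (x : Fin n → G) (y z : G) : G :=
  z * deltaWord x y ^ (m / n) * initialProd x (m % n)

/-- `Δ = w^{n-r} W^r`, where `W = w y` and `m = q n + r` with `0 ≤ r < n`. -/
def garsideWord (m : ℕ) (x : Fin n → G) (y z : G) : G :=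
  wWord m x y z ^ (n - m % n) * (wWord m x y z * y) ^ (m % n)

end Words

/-- The generators `x_1, …, x_n, y, z`. -/
inductive BraidGen (n : ℕ)
  | x (i : Fin n)
  | y
  | z

/-- The relators of the braid group of `W_b^c(k, bn, cm)`, with `m = q n + r`, `0 ≤ r < n`:
* `x_1 ⋯ x_n y z = z x_1 ⋯ x_n y`;
* `x_{i+1} ⋯ x_n y z δ^{q-1} x_1 ⋯ x_{i+r} = x_i ⋯ x_n y z δ^{q-1} x_1 ⋯ x_{i+r-1}`
  for `1 ≤ i ≤ n - r`;
* `x_{i+1} ⋯ x_n y z δ^q x_1 ⋯ x_{i+r-n} = x_i ⋯ x_n y z δ^q x_1 ⋯ x_{i+r-n-1}`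
  for `n - r + 1 ≤ i ≤ n`;
* `y = 1` if `b = 1`, and `z = 1` if `c = 1`. -/
def braidRelators (b n c m : ℕ) : Set (FreeGroup (BraidGen n)) :=
  let x : Fin n → FreeGroup (BraidGen n) := fun i => FreeGroup.of (BraidGen.x i)
  let y : FreeGroup (BraidGen n) := FreeGroup.of BraidGen.y
  let z : FreeGroup (BraidGen n) := FreeGroup.of BraidGen.z
  let δ := deltaWord x y
  let q := m / n
  let r := m % n
  {g | g = (initialProd x n * y * z) * (z * initialProd x n * y)⁻¹} ∪
  {g | ∃ i : ℕ, 1 ≤ i ∧ i ≤ n - r ∧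
    g = (finalProd x i * y * z * δ ^ ((q : ℤ) - 1) * initialProd x (i + r)) *
      (finalProd x (i - 1) * y * z * δ ^ ((q : ℤ) - 1) * initialProd x (i + r - 1))⁻¹} ∪
  {g | ∃ i : ℕ, n - r + 1 ≤ i ∧ i ≤ n ∧
    g = (finalProd x i * y * z * δ ^ q * initialProd x (i + r - n)) *
      (finalProd x (i - 1) * y * z * δ ^ q * initialProd x (i + r - n - 1))⁻¹} ∪
  {g | b = 1 ∧ g = y} ∪
  {g | c = 1 ∧ g = z}

/-- The braid group `B(W_b^c(k, bn, cm))`, which does not depend on `k`, and depends on `b` and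
`c` only through whether they are equal to `1`. -/
abbrev Braid (b n c m : ℕ) : Type := PresentedGroup (braidRelators b n c m)

/-- The generator `x_{i+1}` of the braid group, for `0 ≤ i < n`. -/
def Braid.x (b n c m : ℕ) (i : Fin n) : Braid b n c m := PresentedGroup.of (BraidGen.x i)

/-- The generator `y` of the braid group; it is trivial if `b = 1`. -/
def Braid.y (b n c m : ℕ) : Braid b n c m := PresentedGroup.of BraidGen.y

/-- The generator `z` of the braid group; it is trivial if `c = 1`. -/
def Braid.z (b n c m : ℕ) : Braid b n c m := PresentedGroup.of BraidGen.z

/-- The element `δ = x_1 ⋯ x_n y` of the braid group. -/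
def Braid.δ (b n c m : ℕ) : Braid b n c m := deltaWord (Braid.x b n c m) (Braid.y b n c m)

/-- The element `Δ = w^{n-r} (w y)^r` of the braid group, with `w = z δ^q x_1 ⋯ x_r`. -/
def Braid.Δ (b n c m : ℕ) : Braid b n c m :=
  garsideWord m (Braid.x b n c m) (Braid.y b n c m) (Braid.z b n c m)

section NaturalQuotient

theorem J.s_pow (k n m : ℕ) : J.s k n m ^ k = 1 :=
  PresentedGroup.one_of_mem (rels := jRelators k n m) (x := FreeGroup.of JGen.s ^ k)
    (by simp [jRelators])

theorem J.t_pow (k n m : ℕ) : J.t k n m ^ n = 1 :=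
  PresentedGroup.one_of_mem (rels := jRelators k n m) (x := FreeGroup.of JGen.t ^ n)
    (by simp [jRelators])

theorem J.u_pow (k n m : ℕ) : J.u k n m ^ m = 1 :=
  PresentedGroup.one_of_mem (rels := jRelators k n m) (x := FreeGroup.of JGen.u ^ m)
    (by simp [jRelators])

theorem J.rel₁ (k n m : ℕ) :
    J.s k n m * J.t k n m * J.u k n m = J.t k n m * J.u k n m * J.s k n m :=
  PresentedGroup.mk_eq_mk_of_mul_inv_mem (rels := jRelators k n m)
    (x := FreeGroup.of JGen.s * FreeGroup.of JGen.t * FreeGroup.of JGen.u)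
    (y := FreeGroup.of JGen.t * FreeGroup.of JGen.u * FreeGroup.of JGen.s)
    (by simp [jRelators])

theorem J.rel₂ (k n m : ℕ) :
    J.t k n m * J.u k n m * J.s k n m = J.u k n m * J.s k n m * J.t k n m :=
  PresentedGroup.mk_eq_mk_of_mul_inv_mem (rels := jRelators k n m)
    (x := FreeGroup.of JGen.t * FreeGroup.of JGen.u * FreeGroup.of JGen.s)
    (y := FreeGroup.of JGen.u * FreeGroup.of JGen.s * FreeGroup.of JGen.t)
    (by simp [jRelators])

variable {G H : Type*} [Group G] [Group H] {n : ℕ}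

theorem map_initialProd (f : G →* H) (x : Fin n → G) (j : ℕ) :
    f (initialProd x j) = initialProd (fun i => f (x i)) j := by
  simp [initialProd, map_list_prod, List.map_take, List.map_ofFn, Function.comp_def]

theorem map_finalProd (f : G →* H) (x : Fin n → G) (j : ℕ) :
    f (finalProd x j) = finalProd (fun i => f (x i)) j := by
  simp [finalProd, map_list_prod, List.map_drop, List.map_ofFn, Function.comp_def]

theorem initialProd_conj (s t : G) (j : ℕ) (hj : j ≤ n) :
    initialProd (fun i : Fin n => t ^ (i : ℕ) * s * (t ^ (i : ℕ))⁻¹) j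
      = (s * t) ^ j * (t ^ j)⁻¹ := by
  induction j with
  | zero => simp [initialProd]
  | succ j ih =>
    have h := ih (by omega)
    unfold initialProd at h ⊢
    rw [List.prod_take_succ _ _ (by simpa using hj), h]
    simp only [List.getElem_ofFn]
    rw [pow_succ, pow_succ t]
    group

theorem finalProd_conj (s t : G) (j : ℕ) (hj : j ≤ n) :
    finalProd (fun i : Fin n => t ^ (i : ℕ) * s * (t ^ (i : ℕ))⁻¹) j
      = t ^ j * (s * t) ^ (n - j) * (t ^ n)⁻¹ := by
  have h1 := initialProd_conj (n := n) s t j hj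
  have h2 := initialProd_conj (n := n) s t n le_rfl
  have h3 : initialProd (fun i : Fin n => t ^ (i : ℕ) * s * (t ^ (i : ℕ))⁻¹) j *
      finalProd (fun i : Fin n => t ^ (i : ℕ) * s * (t ^ (i : ℕ))⁻¹) j =
      initialProd (fun i : Fin n => t ^ (i : ℕ) * s * (t ^ (i : ℕ))⁻¹) n := by
    simp [initialProd, finalProd, List.take_of_length_le]
  rw [h1, h2] at h3
  have h4 : (s * t) ^ n = (s * t) ^ j * (s * t) ^ (n - j) := by
    rw [← pow_add]; congr 1; omega
  rw [h4] at h3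
  rw [← eq_inv_mul_iff_mul_eq] at h3
  rw [h3]; group

/-- The images `t^{i-1} s t^{1-i}`, `t^n`, `u^m` of the generators `x_i`, `y`, `z`
in `W_b^c(k, bn, cm)`. -/
def genImage (k b n c m : ℕ) : BraidGen n → W k b n c m
  | .x i => ⟨J.t k (b * n) (c * m) ^ (i : ℕ) * J.s k (b * n) (c * m) *
      (J.t k (b * n) (c * m) ^ (i : ℕ))⁻¹,
      Subgroup.normalClosure_normal.conj_mem _
        (Subgroup.subset_normalClosure (by simp)) _⟩
  | .y => ⟨J.t k (b * n) (c * m) ^ n, Subgroup.subset_normalClosure (by simp)⟩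
  | .z => ⟨J.u k (b * n) (c * m) ^ m, Subgroup.subset_normalClosure (by simp)⟩

theorem genImage_relators (k b n c m : ℕ) :
    ∀ g ∈ braidRelators b n c m, FreeGroup.lift (genImage k b n c m) g = 1 := by
  intro g hg
  apply Subtype.val_injective
  set F : FreeGroup (BraidGen n) →* J k (b * n) (c * m) :=
    (W k b n c m).subtype.comp (FreeGroup.lift (genImage k b n c m)) with hF
  change F g = 1
  set s := J.s k (b * n) (c * m) with hs
  set t := J.t k (b * n) (c * m) with ht
  set u := J.u k (b * n) (c * m) with hu
  have hx (i : Fin n) : F (FreeGroup.of (BraidGen.x i)) = t ^ (i : ℕ) * s * (t ^ (i : ℕ))⁻¹ := by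
    simp [hF, genImage, hs, ht]
  have hy : F (FreeGroup.of BraidGen.y) = t ^ n := by simp [hF, genImage, ht]
  have hz : F (FreeGroup.of BraidGen.z) = u ^ m := by simp [hF, genImage, hu]
  have hcu : Commute (s * t) u := by
    have h : s * t * u = u * (s * t) := by
      rw [← mul_assoc]; exact (J.rel₁ _ _ _).trans (J.rel₂ _ _ _)
    exact h
  have hct : Commute t (s * t * u) := by
    have h : t * (s * t * u) = s * t * u * t := by
      rw [hcu.eq]
      have h2 : t * u * s = u * s * t := J.rel₂ _ _ _
      calc t * (u * (s * t)) = t * u * s * t := by group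
        _ = u * s * t * t := by rw [h2]
        _ = _ := by group
    exact h
  have hI (j : ℕ) (hj : j ≤ n) : F (initialProd (fun i => FreeGroup.of (BraidGen.x i)) j) =
      (s * t) ^ j * (t ^ j)⁻¹ := by
    rw [map_initialProd]; simp only [hx]; exact initialProd_conj s t j hj
  have hE (j : ℕ) (hj : j ≤ n) : F (finalProd (fun i => FreeGroup.of (BraidGen.x i)) j) =
      t ^ j * (s * t) ^ (n - j) * (t ^ n)⁻¹ := by
    rw [map_finalProd]; simp only [hx]; exact finalProd_conj s t j hj
  have hD : F (deltaWord (fun i => FreeGroup.of (BraidGen.x i)) (FreeGroup.of BraidGen.y)) =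
      (s * t) ^ n := by
    simp [deltaWord, hI n le_rfl, hy]
  have hum : Commute (u ^ m) (s * t) := (hcu.pow_right m).symm
  have key (i : ℕ) (e : ℤ) (a : ℕ) (hi : i ≤ n) (ha : a ≤ n)
      (h : (n : ℤ) - i + n * e + a = m) :
      F (finalProd (fun i => FreeGroup.of (BraidGen.x i)) i * FreeGroup.of BraidGen.y *
        FreeGroup.of BraidGen.z *
        deltaWord (fun i => FreeGroup.of (BraidGen.x i)) (FreeGroup.of BraidGen.y) ^ e *
        initialProd (fun i => FreeGroup.of (BraidGen.x i)) a) =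
      (s * t * u) ^ m * (t ^ ((a : ℤ) - i))⁻¹ := by
    simp only [map_mul, map_zpow, hI a ha, hE i hi, hD, hy, hz]
    have e1 : ((s * t) ^ n) ^ e = (s * t) ^ ((n : ℤ) * e) := by
      rw [zpow_mul, zpow_natCast]
    have e2 : (s * t) ^ (n - i) = (s * t) ^ ((n : ℤ) - i) := by
      rw [← zpow_natCast, Nat.cast_sub hi]
    rw [e1, e2, ← zpow_natCast (s * t) a]
    calc _ = t ^ i * (s * t) ^ ((n : ℤ) - i) * (u ^ m * (s * t) ^ ((n : ℤ) * e + a)) * (t ^ a)⁻¹ := by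
          rw [zpow_add]; group
      _ = t ^ i * ((s * t) ^ ((n : ℤ) - i + n * e + a) * u ^ m) * (t ^ a)⁻¹ := by
          rw [(hum.zpow_right _).eq, add_assoc, zpow_add (s * t) ((n : ℤ) - i)]; group
      _ = t ^ i * (s * t * u) ^ m * (t ^ a)⁻¹ := by
          rw [h, zpow_natCast, hcu.mul_pow]
      _ = _ := by
          rw [((hct.pow_left i).pow_right m).eq, zpow_sub]; group
  have hdm := Nat.div_add_mod m n
  have hdm' : (n : ℤ) * ((m / n : ℕ) : ℤ) + ((m % n : ℕ) : ℤ) = m := by exact_mod_cast hdm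
  simp only [braidRelators, Set.mem_union, Set.mem_ofPred_eq] at hg
  rcases hg with (((hg | ⟨i, h1, h2, hg⟩) | ⟨i, h1, h2, hg⟩) | ⟨hb, hg⟩) | ⟨hc, hg⟩
  · subst hg
    simp only [map_mul, map_inv, hI n le_rfl, hy, hz]
    have h := (hum.pow_right n).eq
    rw [mul_inv_eq_one]
    calc _ = (s * t) ^ n * u ^ m := by group
      _ = u ^ m * (s * t) ^ n := h.symm
      _ = _ := by group
  · subst hg
    rw [map_mul, map_inv, key i _ _ (by omega) (by omega),
      key (i - 1) _ _ (by omega) (by omega), mul_inv_eq_one]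
    · congr 3; omega
    · rw [mul_sub]; push_cast [Nat.cast_sub h1, Nat.cast_sub (show 1 ≤ i + m % n by omega)]
      linarith
    · rw [mul_sub]; push_cast; linarith
  · have hr : m % n < n := Nat.mod_lt _ (by omega)
    subst hg
    rw [← zpow_natCast, map_mul, map_inv, key i _ _ (by omega) (by omega),
      key (i - 1) _ _ (by omega) (by omega), mul_inv_eq_one]
    · congr 3; omega
    · rw [← hdm']; generalize (n : ℤ) * ((m / n : ℕ) : ℤ) = A; omega
    · rw [← hdm']; generalize (n : ℤ) * ((m / n : ℕ) : ℤ) = A; omega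
  · subst hg
    subst hb
    rw [hy]
    simpa only [one_mul] using J.t_pow k (1 * n) (c * m)
  · subst hg
    subst hc
    rw [hz]
    simpa only [one_mul] using J.u_pow k (b * n) (1 * m)

/-- The natural quotient `B(W_b^c(k, bn, cm)) → W_b^c(k, bn, cm)`, which sends
`x_i` to `t^{i-1} s t^{1-i}`, `y` to `t^n` and `z` to `u^m`. -/
def naturalQuotient (k b n c m : ℕ) : Braid b n c m →* W k b n c m :=
  PresentedGroup.toGroup (genImage_relators k b n c m)

end NaturalQuotient

end JReflection

/-! Write ζ for the central element stu of J, and let 0 as a parameter of J mean that the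
corresponding relation is absent.

Extend x_1, …, x_n to an infinite sequence X_0, X_1, … on which conjugation by y raises indices by
n. The defining relations then take a symmetric form (`IsBraidSystem`): v = z X_0⋯X_{m-1} commutes
with y, conjugation by v lowers indices by m, and δ commutes with z. Hence Δ = v^n y^m fixes every
X_i and is central, and both Δ and δ^m z^n telescope to z^n X_0⋯X_{nm-1} y^m. In J, X_i becomes t^i
s t^{-i} and Δ becomes ζ^{nm}; counting occurrences of s, for k = 0, shows that Δ has infinite
order.

For the upper bound on the center, work modulo Δ. Since n and m are coprime, Bézout combines v and y
into one element t with t^n = y whose conjugation raises indices by 1 (`IsBraidSystem.exists_root`).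
So the quotient map of the braid group by ⟨Δ⟩ factors through J(0, b₀n, c₀m), where b₀, c₀ ∈ {0, 1}
record whether b, c equal 1, and the second factor kills ζ. The image of the braid group together
with ζ generates this J (`eq_top_of_range_toJ_le`), so a central element lands in the center of J,
which is ⟨ζ⟩, and hence dies modulo Δ. In the same way a central element of H is central in J(k, bn,
cm), so it is a power ζ^l, and ζ^l ∈ H forces nm ∣ l.

The center of J is ⟨ζ⟩ because J/⟨ζ⟩ is the rotation subgroup of a triangle Coxeter group, which
acts faithfully on a real space of dimension three. If the Coxeter diagram is connected, a map
commuting with all rotations is scalar, and determinant 1 makes it the identity. If two parameters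
equal 2 the diagram is disconnected, and J(2, 2, p) is treated by a normal form and an explicit
permutation action. -/

namespace CoxeterSystem

/-! ### Coefficients of the roots of a dihedral group -/

/-- The Chebyshev-type sequence with `p 0 = 0`, `p 1 = 1` and `p (k + 2) = 2 c p (k + 1) - p k`. -/
noncomputable def dihedralCoeff (c : ℝ) : ℕ → ℝ
  | 0 => 0
  | 1 => 1
  | k + 2 => 2 * c * dihedralCoeff c (k + 1) - dihedralCoeff c k

theorem dihedralCoeff_cos (θ : ℝ) (k : ℕ) :
    dihedralCoeff (Real.cos θ) k * Real.sin θ = Real.sin (k * θ) := by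
  induction k using Nat.twoStepInduction with
  | zero => simp [dihedralCoeff]
  | one => simp [dihedralCoeff]
  | more k h1 h2 =>
    have e1 : ((k + 2 : ℕ) : ℝ) * θ = (k + 1 : ℕ) * θ + θ := by push_cast; ring
    have e2 : (k : ℝ) * θ = (k + 1 : ℕ) * θ - θ := by push_cast; ring
    rw [dihedralCoeff, sub_mul, h1, mul_assoc, h2, e1, e2, Real.sin_add, Real.sin_sub]
    ring

theorem dihedralCoeff_nonneg_of_one_le {c : ℝ} (hc : 1 ≤ c) (k : ℕ) : 0 ≤ dihedralCoeff c k := by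
  have h : 0 ≤ dihedralCoeff c k ∧ dihedralCoeff c k ≤ dihedralCoeff c (k + 1) := by
    induction k with
    | zero => simp [dihedralCoeff]
    | succ k ih => exact ⟨ih.1.trans ih.2, by rw [dihedralCoeff]; nlinarith⟩
  exact h.1

/-- The number `-B(α_i, α_j)` for two distinct simple roots whose reflections have a product
of order `m`, with the convention that `m = 0` stands for `∞`. -/
noncomputable def rootCos (m : ℕ) : ℝ := if m = 0 then 2 else Real.cos (Real.pi / m)

theorem sin_pi_div_pos {m : ℕ} (hm : 2 ≤ m) : 0 < Real.sin (Real.pi / m) := by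
  have h : (2 : ℝ) ≤ m := by exact_mod_cast hm
  apply Real.sin_pos_of_pos_of_lt_pi
  · exact div_pos Real.pi_pos (by linarith)
  · exact div_lt_self Real.pi_pos (by linarith)

/-- For finite m the value is sin(kπ/m) / sin(π/m) with kπ/m ≤ π; for m = 0 the sequence is
nondecreasing because 2 ≥ 1. -/
theorem dihedralCoeff_rootCos_nonneg {m : ℕ} (hm : m ≠ 1) {k : ℕ} (hk : m = 0 ∨ k ≤ m) :
    0 ≤ dihedralCoeff (rootCos m) k := by
  rcases eq_or_ne m 0 with rfl | h0
  · exact dihedralCoeff_nonneg_of_one_le (by norm_num [rootCos]) k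
  · have hk : k ≤ m := hk.resolve_left h0
    have hs := sin_pi_div_pos (show 2 ≤ m by omega)
    have h := dihedralCoeff_cos (Real.pi / m) k
    rw [rootCos, if_neg h0]
    have hm0 : (0 : ℝ) < m := by positivity
    have : 0 ≤ Real.sin (k * (Real.pi / m)) := by
      apply Real.sin_nonneg_of_nonneg_of_le_pi
      · have := Real.pi_pos; positivity
      · rw [mul_div_assoc', div_le_iff₀ hm0, mul_comm]
        exact mul_le_mul_of_nonneg_left (by exact_mod_cast hk) Real.pi_pos.le
    rw [← h] at this
    exact nonneg_of_mul_nonneg_left this hs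

/-- This is the benefit of the value 2, instead of the customary 1, for infinite order: the form is
nondegenerate on the plane of any two simple roots. -/
theorem rootCos_sq_ne_one {m : ℕ} (hm : m ≠ 1) : rootCos m ^ 2 ≠ 1 := by
  rcases eq_or_ne m 0 with rfl | h0
  · norm_num [rootCos]
  · have hs := sin_pi_div_pos (show 2 ≤ m by omega)
    rw [rootCos, if_neg h0]
    nlinarith [Real.sin_sq_add_cos_sq (Real.pi / m)]

theorem rootCos_ne_zero {m : ℕ} (h2 : m ≠ 2) : rootCos m ≠ 0 := by
  rcases eq_or_ne m 0 with rfl | h0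
  · norm_num [rootCos]
  rcases eq_or_ne m 1 with rfl | h1
  · norm_num [rootCos]
  · rw [rootCos, if_neg h0]
    have h : (3 : ℝ) ≤ m := by exact_mod_cast (show 3 ≤ m by omega)
    have hpi := Real.pi_pos
    apply ne_of_gt
    apply Real.cos_pos_of_mem_Ioo
    constructor
    · have : 0 < Real.pi / m := by positivity
      linarith
    · rw [div_lt_div_iff₀ (by linarith) (by norm_num)]
      nlinarith

/-! ### Positivity of roots and faithfulness of geometric representations -/

section Positivity

variable {B W : Type*} [Group W] {M : CoxeterMatrix B} [DecidableEq B]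

/-- A representation of a Coxeter group on the space spanned by the simple roots, given on the
simple roots by the usual formulas. -/
structure IsGeometric (cs : CoxeterSystem M W) (ρ : W →* Module.End ℝ (B → ℝ)) : Prop where
  self (i : B) : ρ (cs.simple i) (Pi.single i 1) = -Pi.single i 1
  other {i j : B} (h : i ≠ j) : ρ (cs.simple i) (Pi.single j 1) =
    Pi.single j 1 + (2 * rootCos (M i j)) • Pi.single i 1

namespace IsGeometric

variable {cs : CoxeterSystem M W} {ρ : W →* Module.End ℝ (B → ℝ)}

theorem alternatingWord_apply (hρ : cs.IsGeometric ρ) {i j : B} (hij : i ≠ j) (k : ℕ) :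
    ρ (cs.wordProd (alternatingWord i j k)) (Pi.single i 1) =
      dihedralCoeff (rootCos (M i j)) (k + 1) • Pi.single (if Even k then i else j) 1 +
      dihedralCoeff (rootCos (M i j)) k • Pi.single (if Even k then j else i) (1 : ℝ) := by
  induction k with
  | zero => simp [alternatingWord, dihedralCoeff]
  | succ k ih =>
    rw [alternatingWord_succ', cs.wordProd_cons, map_mul, Module.End.mul_apply, ih, map_add,
      map_smul, map_smul]
    by_cases h : Even k
    · have h' : ¬ Even (k + 1) := by simpa [parity_simps] using h
      simp only [if_pos h, if_neg h', hρ.self, hρ.other hij.symm, M.symmetric j i, dihedralCoeff]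
      module
    · have h' : Even (k + 1) := by simpa [parity_simps] using h
      simp only [if_neg h, if_pos h', hρ.self, hρ.other hij, dihedralCoeff]
      module

/-- Induction on length. Split off from w the longest alternating suffix in i and j, leaving v with
neither i nor j as right descent. Then w α_i is a combination of v α_i and v α_j, nonnegative by
induction, with dihedral coefficients that are nonnegative too. -/
theorem nonneg_of_not_isRightDescent (hρ : cs.IsGeometric ρ) {w : W} {i : B}
    (h : ¬ cs.IsRightDescent w i) (b : B) : 0 ≤ ρ w (Pi.single i 1) b := by
  induction hn : cs.length w using Nat.strong_induction_on generalizing w i with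
  | _ n ih =>
  rcases eq_or_ne w 1 with rfl | hw
  · rw [map_one, Module.End.one_apply]
    by_cases hb : b = i
    · subst hb; simp
    · simp [hb]
  obtain ⟨j, hj⟩ := cs.exists_rightDescent_of_ne_one hw
  have hij : i ≠ j := by rintro rfl; exact h hj
  -- The alternating suffix of length k ends in j, and the lengths of the two factors must add up. A
  -- maximal k exists since k is at most the length of w.
  let P : ℕ → Prop := fun k => ∃ v, w = v * cs.wordProd (alternatingWord i j k) ∧
    cs.length w = cs.length v + k
  classical
  have hP1 : P 1 := by
    refine ⟨w * cs.simple j, by simp [alternatingWord], ?_⟩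
    have := cs.isRightDescent_iff.mp hj
    omega
  have hb1 : 1 ≤ n := by
    have := cs.isRightDescent_iff.mp hj
    omega
  obtain ⟨k, hk⟩ : ∃ k, k = Nat.findGreatest P n := ⟨_, rfl⟩
  have hk1 : 1 ≤ k := hk ▸ Nat.le_findGreatest hb1 hP1
  obtain ⟨v, hv, hl⟩ : P k := hk ▸ Nat.findGreatest_spec hb1 hP1
  have hmax : ¬ P (k + 1) := by
    intro hp
    have hle : k + 1 ≤ n := by obtain ⟨v', -, hl'⟩ := hp; omega
    have := Nat.le_findGreatest hle hp
    omega
  have h1 : ¬ cs.IsRightDescent v (if Even k then j else i) := by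
    intro hd
    apply hmax
    refine ⟨v * cs.simple (if Even k then j else i), ?_, ?_⟩
    · rw [alternatingWord_succ', cs.wordProd_cons, hv]
      simp [mul_assoc]
    · have := cs.isRightDescent_iff.mp hd
      omega
  -- This letter is the first one of the suffix: as a descent of v it would cancel, making w too
  -- short.
  have h2 : ¬ cs.IsRightDescent v (if Even k then i else j) := by
    obtain ⟨k', rfl⟩ : ∃ k', k = k' + 1 := ⟨k - 1, by omega⟩
    intro hd
    have e : (if Even (k' + 1) then i else j) = if Even k' then j else i := by
      by_cases h : Even k' <;> simp [h, parity_simps]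
    rw [e] at hd
    have hlt := cs.isRightDescent_iff.mp hd
    rw [alternatingWord_succ', cs.wordProd_cons, ← mul_assoc] at hv
    have a1 := cs.length_mul_le (v * cs.simple (if Even k' then j else i))
      (cs.wordProd (alternatingWord i j k'))
    have a2 := cs.length_wordProd_le (alternatingWord i j k')
    rw [length_alternatingWord] at a2
    rw [← hv] at a1
    omega
  have hred : cs.IsReduced (alternatingWord i j k) := by
    have a1 := cs.length_mul_le v (cs.wordProd (alternatingWord i j k))
    have a2 := cs.length_wordProd_le (alternatingWord i j k)
    rw [← hv] at a1
    rw [length_alternatingWord] at a2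
    rw [IsReduced, length_alternatingWord]
    omega
  -- A longer alternating word is not reduced. One of length exactly `M i j` can be rewritten by the
  -- braid relation to end in i, making i a descent of w.
  have hkM : M i j = 0 ∨ k + 1 ≤ M i j := by
    by_contra! hcon
    obtain ⟨hM, hlt⟩ := hcon
    rcases (show M i j < k ∨ k = M i j by omega) with hgt | heq
    · exact cs.not_isReduced_alternatingWord i j hM hgt hred
    · apply h
      have hbr := cs.wordProd_braidWord_eq i j
      simp only [braidWord, M.symmetric j i, ← heq] at hbr
      obtain ⟨k', rfl⟩ : ∃ k', k = k' + 1 := ⟨k - 1, by omega⟩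
      rw [hbr, alternatingWord_succ, cs.wordProd_concat] at hv
      have a1 := cs.length_mul_le v (cs.wordProd (alternatingWord i j k'))
      have a2 := cs.length_wordProd_le (alternatingWord i j k')
      rw [length_alternatingWord] at a2
      rw [IsRightDescent, show w * cs.simple i = v * cs.wordProd (alternatingWord i j k') by
        rw [hv]; simp [mul_assoc]]
      omega
  have hM1 : M i j ≠ 1 := M.off_diagonal i j hij
  rw [hv, map_mul, Module.End.mul_apply, hρ.alternatingWord_apply hij, map_add, map_smul, map_smul]
  have p1 := ih (cs.length v) (by omega) h1 rfl
  have p2 := ih (cs.length v) (by omega) h2 rfl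
  have c1 := dihedralCoeff_rootCos_nonneg hM1 hkM
  have c2 := dihedralCoeff_rootCos_nonneg hM1 (k := k) (hkM.imp_right (by omega))
  simp only [Pi.add_apply, Pi.smul_apply, smul_eq_mul]
  positivity

/-- If w ≠ 1 acts trivially and i is a right descent of w, then w s_i sends α_i to -α_i, although i
is not a descent of w s_i. -/
theorem injective (hρ : cs.IsGeometric ρ) : Function.Injective ρ := by
  rw [injective_iff_map_eq_one]
  intro w hw
  by_contra hne
  obtain ⟨i, hi⟩ := cs.exists_rightDescent_of_ne_one hne
  have h := hρ.nonneg_of_not_isRightDescent (cs.isRightDescent_iff_not_isRightDescent_mul.mp hi) i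
  rw [map_mul, Module.End.mul_apply, hρ.self, hw, Module.End.one_apply] at h
  norm_num at h

end IsGeometric

end Positivity

/-! ### Construction of the geometric representation -/

section Existence

variable {B : Type*} [DecidableEq B] [Fintype B] (M : CoxeterMatrix B)

/-- Twice the bilinear form, paired with the simple root `α_i`. -/
noncomputable def simpleCoroot (i : B) : (B → ℝ) →ₗ[ℝ] ℝ :=
  Fintype.linearCombination ℝ fun j => if i = j then 2 else -(2 * rootCos (M i j))

theorem simpleCoroot_self (i : B) : simpleCoroot M i (Pi.single i 1) = 2 := by
  simp [simpleCoroot]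

theorem simpleCoroot_other {i j : B} (h : i ≠ j) :
    simpleCoroot M i (Pi.single j 1) = -(2 * rootCos (M i j)) := by
  simp [simpleCoroot, h]

/-- The reflection in the simple root `α_i`. -/
noncomputable def rootReflection (i : B) : Module.End ℝ (B → ℝ) :=
  LinearMap.id - (simpleCoroot M i).smulRight (Pi.single i 1)

theorem rootReflection_apply (i : B) (v : B → ℝ) :
    rootReflection M i v = v - simpleCoroot M i v • Pi.single i 1 := rfl

theorem rootReflection_self (i : B) :
    rootReflection M i (Pi.single i 1) = -Pi.single i 1 := by
  rw [rootReflection_apply, simpleCoroot_self]; module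

theorem rootReflection_other {i j : B} (h : i ≠ j) : rootReflection M i (Pi.single j 1) =
    Pi.single j 1 + (2 * rootCos (M i j)) • Pi.single i 1 := by
  rw [rootReflection_apply, simpleCoroot_other M h]; module

theorem rootReflection_mul_self (i : B) : rootReflection M i * rootReflection M i = 1 := by
  refine LinearMap.ext fun v => ?_
  rw [Module.End.mul_apply, rootReflection_apply M i v, map_sub, map_smul, rootReflection_self,
    rootReflection_apply, Module.End.one_apply]
  module

theorem rootReflection_mul_pow_apply {i j : B} (hij : i ≠ j) (k : ℕ) :
    ((rootReflection M i * rootReflection M j) ^ k) (Pi.single i 1) =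
      dihedralCoeff (rootCos (M i j)) (2 * k + 1) • Pi.single i 1 +
      dihedralCoeff (rootCos (M i j)) (2 * k) • Pi.single j (1 : ℝ) := by
  induction k with
  | zero => simp [dihedralCoeff]
  | succ k ih =>
    rw [pow_succ', Module.End.mul_apply, ih, Module.End.mul_apply]
    simp only [map_add, map_smul, map_neg, rootReflection_self, rootReflection_other M hij,
      rootReflection_other M hij.symm, M.symmetric j i, smul_add, smul_neg,
      show 2 * (k + 1) = 2 * k + 2 from rfl, dihedralCoeff]
    module

/-- The exponent is k + 1 because the coefficients for exponent k would have indices 2k and 2k - 1.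
-/
theorem rootReflection_mul_pow_succ_apply' {i j : B} (hij : i ≠ j) (k : ℕ) :
    ((rootReflection M i * rootReflection M j) ^ (k + 1)) (Pi.single j 1) =
      -dihedralCoeff (rootCos (M i j)) (2 * k + 2) • Pi.single i 1 -
      dihedralCoeff (rootCos (M i j)) (2 * k + 1) • Pi.single j (1 : ℝ) := by
  induction k with
  | zero =>
    simp only [zero_add, pow_one, Module.End.mul_apply, rootReflection_self, map_neg,
      rootReflection_other M hij, dihedralCoeff]
    module
  | succ k ih =>
    rw [pow_succ', Module.End.mul_apply, ih, Module.End.mul_apply]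
    simp only [map_add, map_sub, map_smul, map_neg, rootReflection_self,
      rootReflection_other M hij, rootReflection_other M hij.symm, M.symmetric j i, smul_add,
      smul_neg, show 2 * (k + 1) = 2 * k + 2 from rfl, dihedralCoeff]
    module

/-- With θ = π/m the coefficients are sin(jθ) / sin θ, of period 2m in j. The last one has index 2m
- 1 and follows from the recurrence. -/
theorem dihedralCoeff_rootCos_period {m : ℕ} (hm : 2 ≤ m) :
    dihedralCoeff (rootCos m) (2 * m) = 0 ∧ dihedralCoeff (rootCos m) (2 * m + 1) = 1 ∧
    dihedralCoeff (rootCos m) (2 * (m - 1) + 1) = -1 := by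
  have hs := sin_pi_div_pos hm
  have hm0 : (m : ℝ) ≠ 0 := by positivity
  have h0 : dihedralCoeff (rootCos m) (2 * m) = 0 := by
    have h := dihedralCoeff_cos (Real.pi / m) (2 * m)
    rw [show ((2 * m : ℕ) : ℝ) * (Real.pi / m) = 2 * Real.pi by push_cast; field_simp,
      Real.sin_two_pi] at h
    rw [rootCos, if_neg (by omega)]
    exact (mul_eq_zero.mp h).resolve_right hs.ne'
  have h1 : dihedralCoeff (rootCos m) (2 * m + 1) = 1 := by
    have h := dihedralCoeff_cos (Real.pi / m) (2 * m + 1)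
    rw [show ((2 * m + 1 : ℕ) : ℝ) * (Real.pi / m) = Real.pi / m + 2 * Real.pi by
      push_cast; field_simp; ring, Real.sin_add_two_pi] at h
    rw [rootCos, if_neg (by omega)]
    exact mul_right_cancel₀ hs.ne' (by rw [h, one_mul])
  refine ⟨h0, h1, ?_⟩
  obtain ⟨l, rfl⟩ : ∃ l, m = l + 1 := ⟨m - 1, by omega⟩
  rw [show 2 * (l + 1) + 1 = (2 * l + 1) + 2 by ring, dihedralCoeff,
    show 2 * l + 1 + 1 = 2 * (l + 1) by ring, h0] at h1
  simp only [Nat.add_sub_cancel]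
  linarith

theorem rootReflection_mul_pow (i j : B) :
    (rootReflection M i * rootReflection M j) ^ M i j = 1 := by
  rcases eq_or_ne i j with rfl | hij
  · rw [M.diagonal, pow_one, rootReflection_mul_self]
  have hm1 := M.off_diagonal i j hij
  rcases eq_or_ne (M i j) 0 with h0 | h0
  · rw [h0, pow_zero]
  have hm : 2 ≤ M i j := by omega
  obtain ⟨p0, p1, p2⟩ := dihedralCoeff_rootCos_period hm
  have hi := rootReflection_mul_pow_apply M hij (M i j)
  rw [p0, p1, one_smul, zero_smul, add_zero] at hi
  have hj := rootReflection_mul_pow_succ_apply' M hij (M i j - 1)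
  rw [p2, show 2 * (M i j - 1) + 2 = 2 * M i j by omega, p0,
    show M i j - 1 + 1 = M i j by omega] at hj
  set c := rootCos (M i j) with hc
  have hc1 : 1 - c ^ 2 ≠ 0 := sub_ne_zero.mpr (rootCos_sq_ne_one hm1).symm
  refine LinearMap.ext fun v => ?_
  -- Splitting v along the plane of α_i, α_j and the common kernel of the two coroots: x and y solve
  -- 2x - 2cy = f_i(v), -2cx + 2y = f_j(v), where f_i, f_j are the coroots and c² ≠ 1.
  obtain ⟨x, hx⟩ : ∃ x, x = (simpleCoroot M i v + c * simpleCoroot M j v) / (2 * (1 - c ^ 2)) :=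
    ⟨_, rfl⟩
  obtain ⟨y, hy⟩ : ∃ y, y = (c * simpleCoroot M i v + simpleCoroot M j v) / (2 * (1 - c ^ 2)) :=
    ⟨_, rfl⟩
  obtain ⟨u, hu⟩ : ∃ u, u = v - x • Pi.single i 1 - y • Pi.single j 1 := ⟨_, rfl⟩
  have fi : simpleCoroot M i u = 0 := by
    simp only [hu, map_sub, map_smul, simpleCoroot_self, simpleCoroot_other M hij, ← hc, hx, hy,
      smul_eq_mul]
    field_simp
    ring
  have fj : simpleCoroot M j u = 0 := by
    simp only [hu, map_sub, map_smul, simpleCoroot_self, simpleCoroot_other M hij.symm,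
      M.symmetric j i, ← hc, hx, hy, smul_eq_mul]
    field_simp
    ring
  have hfix : (rootReflection M i * rootReflection M j) u = u := by
    rw [Module.End.mul_apply, rootReflection_apply M j, fj, zero_smul, sub_zero,
      rootReflection_apply, fi, zero_smul, sub_zero]
  have hfix' (k : ℕ) : ((rootReflection M i * rootReflection M j) ^ k) u = u := by
    induction k with
    | zero => simp
    | succ k ih => rw [pow_succ, Module.End.mul_apply, hfix, ih]
  have hv : v = u + x • Pi.single i 1 + y • Pi.single j 1 := by rw [hu]; module
  rw [hv, map_add, map_add, map_smul, map_smul, hfix', hi, hj, Module.End.one_apply]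
  module

variable {M} {W : Type*} [Group W]

/-- The geometric representation of a Coxeter group. -/
noncomputable def geometricRep (cs : CoxeterSystem M W) : W →* Module.End ℝ (B → ℝ) :=
  cs.lift ⟨rootReflection M, rootReflection_mul_pow M⟩

theorem geometricRep_simple (cs : CoxeterSystem M W) (i : B) :
    cs.geometricRep (cs.simple i) = rootReflection M i := cs.lift_apply_simple _ _

theorem isGeometric_geometricRep (cs : CoxeterSystem M W) : cs.IsGeometric cs.geometricRep where
  self i := by rw [geometricRep_simple, rootReflection_self]
  other h := by rw [geometricRep_simple, rootReflection_other M h]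

end Existence

/-! ### Linear maps commuting with rotations -/

section Commutant

variable {B W : Type*} [Group W] {M : CoxeterMatrix B} [DecidableEq B] [Fintype B]

theorem rootReflection_apply_of_ne {i l : B} (h : l ≠ i) (v : B → ℝ) :
    rootReflection M i v l = v l := by
  simp [rootReflection_apply, h]

/-- The reflections in α_i and α_j do not change the l-th coordinate, so v ↦ (R v)_l is invariant
under their product. On the plane of α_i, α_j that product has no eigenvalue 1, as c² ≠ 1, so an
invariant functional vanishes there. -/
theorem apply_single_eq_zero_of_commute {R : Module.End ℝ (B → ℝ)} {i j l : B} (hij : i ≠ j)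
    (hli : l ≠ i) (hlj : l ≠ j) (h : Commute R (rootReflection M i * rootReflection M j)) :
    R (Pi.single i 1) l = 0 := by
  have key (v : B → ℝ) : R (rootReflection M i (rootReflection M j v)) l = R v l := by
    have := congrArg (fun F : Module.End ℝ (B → ℝ) => F v l) h.eq
    simpa only [Module.End.mul_apply, rootReflection_apply_of_ne hli,
      rootReflection_apply_of_ne hlj] using this
  have h1 := key (Pi.single i 1)
  have h2 := key (Pi.single j 1)
  simp only [rootReflection_self, rootReflection_other M hij, rootReflection_other M hij.symm,
    M.symmetric j i, map_add, map_neg, map_smul, Pi.add_apply, Pi.neg_apply, Pi.smul_apply,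
    smul_eq_mul] at h1 h2
  set c := rootCos (M i j)
  have hc : c ^ 2 - 1 ≠ 0 := sub_ne_zero.mpr (rootCos_sq_ne_one (M.off_diagonal i j hij))
  have h3 : (c ^ 2 - 1) * R (Pi.single i 1) l = 0 := by linear_combination h1 / 2 + c * h2 / 2
  exact (mul_eq_zero.mp h3).resolve_left hc

/-- The product of the two reflections sends α_j to -α_j - 2c α_i with c ≠ 0; the α_i-coordinates of
the two composites give c d_i = c d_j. -/
theorem eq_of_commute_of_diagonal {R : Module.End ℝ (B → ℝ)} {i j : B} (hij : i ≠ j)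
    (hM : M i j ≠ 2) (d : B → ℝ) (hd : ∀ i, R (Pi.single i 1) = d i • Pi.single i 1)
    (h : Commute R (rootReflection M i * rootReflection M j)) : d i = d j := by
  have := congrArg (fun F : Module.End ℝ (B → ℝ) => F (Pi.single j 1) i) h.eq
  simp only [Module.End.mul_apply, rootReflection_self, rootReflection_other M hij, map_add,
    map_neg, map_smul, hd, Pi.add_apply, Pi.neg_apply, Pi.smul_apply, smul_eq_mul,
    Pi.single_eq_same, Pi.single_eq_of_ne hij] at this
  have hc := rootCos_ne_zero hM
  apply mul_left_cancel₀ (mul_ne_zero two_ne_zero hc)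
  linear_combination -this

end Commutant

section RankThree

variable {W : Type*} [Group W] {M : CoxeterMatrix (Fin 3)}

theorem det_rootReflection (i : Fin 3) : LinearMap.det (rootReflection M i) = -1 := by
  rw [← LinearMap.det_toMatrix', Matrix.det_fin_three]
  obtain rfl | rfl | rfl : i = 0 ∨ i = 1 ∨ i = 2 := by revert i; decide
  all_goals
    simp [LinearMap.toMatrix'_apply, rootReflection_self, rootReflection_other]

/-- In a Coxeter group of rank three whose diagram is connected, a rotation commuting with all
rotations is trivial. -/
theorem eq_one_of_commute_rotations (cs : CoxeterSystem M W)
    (hM : ∃ i : Fin 3, ∀ j, j ≠ i → M i j ≠ 2) {w : W}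
    (hdet : LinearMap.det (cs.geometricRep w) = 1)
    (hw : ∀ i j, Commute w (cs.simple i * cs.simple j)) : w = 1 := by
  set R := cs.geometricRep w with hR
  have hc (i j : Fin 3) : Commute R (rootReflection M i * rootReflection M j) := by
    have := (hw i j).map cs.geometricRep
    rwa [map_mul, geometricRep_simple, geometricRep_simple] at this
  -- Rank three enters here: the j different from i and l gives a rotation that leaves the l-th
  -- coordinate unchanged.
  have hoff (i l : Fin 3) (hli : l ≠ i) : R (Pi.single i 1) l = 0 := by
    obtain ⟨j, hji, hjl⟩ : ∃ j : Fin 3, j ≠ i ∧ j ≠ l := by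
      revert i l; decide
    exact apply_single_eq_zero_of_commute hji.symm hli hjl.symm (hc i j)
  have hd (i : Fin 3) : R (Pi.single i 1) = R (Pi.single i 1) i • Pi.single i 1 := by
    ext l
    rcases eq_or_ne l i with rfl | h
    · simp
    · simp [h, hoff i l h]
  obtain ⟨i, hi⟩ := hM
  have hscal : R = (R (Pi.single i 1) i) • (1 : Module.End ℝ (Fin 3 → ℝ)) := by
    refine (Pi.basisFun ℝ (Fin 3)).ext fun j => ?_
    rw [Pi.basisFun_apply, LinearMap.smul_apply, Module.End.one_apply, hd j]
    congr 1
    rcases eq_or_ne j i with rfl | hj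
    · rfl
    · exact (eq_of_commute_of_diagonal hj.symm (hi j hj) (fun i => R (Pi.single i 1) i) hd
        (hc i j)).symm
  rw [hscal, LinearMap.det_smul] at hdet
  simp only [Module.finrank_fin_fun, map_one, mul_one] at hdet
  -- The scalar is real with cube 1.
  have h1 : R (Pi.single i 1) i = 1 := by
    nlinarith [sq_nonneg (R (Pi.single i 1) i + 1), sq_nonneg (R (Pi.single i 1) i - 1)]
  rw [h1, one_smul] at hscal
  apply cs.isGeometric_geometricRep.injective
  rw [← hR, hscal, map_one]

end RankThree

end CoxeterSystem

namespace JReflection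

/-! ### Universal property of J and its central element -/

section Universal

variable {k n m : ℕ} {G : Type*} [Group G]

/-- The homomorphism out of `J(k, n, m)` with prescribed images of the generators. -/
def J.lift (a b c : G) (ha : a ^ k = 1) (hb : b ^ n = 1) (hc : c ^ m = 1)
    (h1 : a * b * c = b * c * a) (h2 : b * c * a = c * a * b) : J k n m →* G :=
  PresentedGroup.toGroup (f := fun | .s => a | .t => b | .u => c) (by
    intro r hr
    simp only [jRelators, Set.mem_insert_iff, Set.mem_singleton_iff] at hr
    rcases hr with rfl | rfl | rfl | rfl | rfl 
    · simpa using ha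
    · simpa using hb
    · simpa using hc
    · simpa only [map_mul, map_inv, FreeGroup.lift_apply_of, mul_inv_eq_one] using h1
    · simpa only [map_mul, map_inv, FreeGroup.lift_apply_of, mul_inv_eq_one] using h2)

section

variable (a b c : G) (ha : a ^ k = 1) (hb : b ^ n = 1) (hc : c ^ m = 1)
  (h1 : a * b * c = b * c * a) (h2 : b * c * a = c * a * b)

theorem J.lift_s : J.lift a b c ha hb hc h1 h2 (J.s k n m) = a := PresentedGroup.toGroup.of _

theorem J.lift_t : J.lift a b c ha hb hc h1 h2 (J.t k n m) = b := PresentedGroup.toGroup.of _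

theorem J.lift_u : J.lift a b c ha hb hc h1 h2 (J.u k n m) = c := PresentedGroup.toGroup.of _

end

theorem J.hom_ext {f g : J k n m →* G} (hs : f (J.s k n m) = g (J.s k n m))
    (ht : f (J.t k n m) = g (J.t k n m)) (hu : f (J.u k n m) = g (J.u k n m)) : f = g :=
  PresentedGroup.ext fun x => by cases x <;> assumption

theorem J.induction_on {p : Subgroup (J k n m)} (hs : J.s k n m ∈ p) (ht : J.t k n m ∈ p)
    (hu : J.u k n m ∈ p) : p = ⊤ := by
  rw [eq_top_iff, ← PresentedGroup.closure_range_of, Subgroup.closure_le]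
  rintro _ ⟨x, rfl⟩
  cases x <;> assumption

/-- The central element `stu` of `J(k, n, m)`. -/
def J.z (k n m : ℕ) : J k n m := J.s k n m * J.t k n m * J.u k n m

theorem J.z_mem_center : J.z k n m ∈ Subgroup.center (J k n m) := by
  have h1 := J.rel₁ k n m
  have h2 := J.rel₂ k n m
  have h : Subgroup.centralizer {J.z k n m} = ⊤ := by
    apply J.induction_on <;> rw [Subgroup.mem_centralizer_singleton_iff, J.z]
    · simp only [mul_assoc] at h1 ⊢
      rw [h1]
    · rw [h1, h2]
      nth_rw 2 [← h2]
      simp only [mul_assoc]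
    · rw [h1, h2]
      simp only [mul_assoc] at h1 h2 ⊢
      rw [← h2, ← h1]
  rw [Subgroup.mem_center_iff]
  intro g
  exact Subgroup.mem_centralizer_singleton_iff.mp (h ▸ Subgroup.mem_top g)

instance : (Subgroup.zpowers (J.z k n m)).Normal where
  conj_mem x hx g := by
    have hc := (Subgroup.zpowers_le.mpr J.z_mem_center) hx
    rw [Subgroup.mem_center_iff.mp hc g, mul_inv_cancel_right]
    exact hx

end Universal

/-! ### The von Dyck group as rotation subgroup of a triangle group -/

section VonDyck

variable (k n m : ℕ)

/-- The von Dyck group `⟨s, t, u ∣ s^k = t^n = u^m = stu = 1⟩`. -/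
abbrev VonDyck : Type := J k n m ⧸ Subgroup.zpowers (J.z k n m)

/-- The image of an element of `J(k, n, m)` in the von Dyck group. -/
abbrev VonDyck.mk : J k n m →* VonDyck k n m := QuotientGroup.mk' _

variable {k n m}

theorem VonDyck.mk_z : VonDyck.mk k n m (J.z k n m) = 1 :=
  (QuotientGroup.eq_one_iff _).mpr (Subgroup.mem_zpowers _)

theorem VonDyck.mk_u : VonDyck.mk k n m (J.u k n m) =
    (VonDyck.mk k n m (J.s k n m) * VonDyck.mk k n m (J.t k n m))⁻¹ := by
  have := VonDyck.mk_z (k := k) (n := n) (m := m)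
  change VonDyck.mk k n m (J.s k n m * J.t k n m * J.u k n m) = 1 at this
  rw [map_mul, map_mul] at this
  exact eq_inv_of_mul_eq_one_right this

theorem VonDyck.hom_ext {G : Type*} [Group G] {f g : VonDyck k n m →* G}
    (hs : f (VonDyck.mk k n m (J.s k n m)) = g (VonDyck.mk k n m (J.s k n m)))
    (ht : f (VonDyck.mk k n m (J.t k n m)) = g (VonDyck.mk k n m (J.t k n m))) : f = g := by
  apply QuotientGroup.monoidHom_ext
  apply J.hom_ext hs ht
  change f (VonDyck.mk k n m (J.u k n m)) = g (VonDyck.mk k n m (J.u k n m))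
  rw [VonDyck.mk_u, map_inv, map_inv, map_mul, map_mul, hs, ht]

/-- Inverting s and t sends u = (st)⁻¹ to ts. Being conjugate to u⁻¹, this satisfies the relation on
the m-th power, so the inversion is well defined. -/
theorem VonDyck.mk_t_mul_mk_s : VonDyck.mk k n m (J.t k n m) * VonDyck.mk k n m (J.s k n m) =
    (VonDyck.mk k n m (J.s k n m))⁻¹ * (VonDyck.mk k n m (J.u k n m))⁻¹ *
      (VonDyck.mk k n m (J.s k n m))⁻¹⁻¹ := by
  rw [VonDyck.mk_u]; group

/-- The homomorphism to the von Dyck group that inverts `s` and `t`. -/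
def VonDyck.flipAux : J k n m →* VonDyck k n m :=
  J.lift (VonDyck.mk k n m (J.s k n m))⁻¹ (VonDyck.mk k n m (J.t k n m))⁻¹
    (VonDyck.mk k n m (J.t k n m) * VonDyck.mk k n m (J.s k n m))
    (by rw [inv_pow, ← map_pow, J.s_pow, map_one, inv_one])
    (by rw [inv_pow, ← map_pow, J.t_pow, map_one, inv_one])
    (by rw [VonDyck.mk_t_mul_mk_s, conj_pow, inv_pow, ← map_pow, J.u_pow]; simp)
    (by group) (by group)

theorem VonDyck.flipAux_s : VonDyck.flipAux (J.s k n m) = (VonDyck.mk k n m (J.s k n m))⁻¹ := by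
  unfold VonDyck.flipAux; exact J.lift_s ..

theorem VonDyck.flipAux_t : VonDyck.flipAux (J.t k n m) = (VonDyck.mk k n m (J.t k n m))⁻¹ := by
  unfold VonDyck.flipAux; exact J.lift_t ..

theorem VonDyck.flipAux_u : VonDyck.flipAux (J.u k n m) =
    VonDyck.mk k n m (J.t k n m) * VonDyck.mk k n m (J.s k n m) := by
  unfold VonDyck.flipAux; exact J.lift_u ..

/-- The endomorphism of the von Dyck group that inverts `s` and `t`. -/
def VonDyck.flipHom : VonDyck k n m →* VonDyck k n m :=
  QuotientGroup.lift _ VonDyck.flipAux (by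
      rw [Subgroup.zpowers_le, MonoidHom.mem_ker]
      change VonDyck.flipAux (J.s k n m * J.t k n m * J.u k n m) = 1
      rw [map_mul, map_mul, flipAux_s, flipAux_t, flipAux_u]
      group)

theorem VonDyck.flipHom_s : VonDyck.flipHom (VonDyck.mk k n m (J.s k n m)) =
    (VonDyck.mk k n m (J.s k n m))⁻¹ := VonDyck.flipAux_s

theorem VonDyck.flipHom_t : VonDyck.flipHom (VonDyck.mk k n m (J.t k n m)) =
    (VonDyck.mk k n m (J.t k n m))⁻¹ := VonDyck.flipAux_t

theorem VonDyck.flipHom_comp_self :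
    (VonDyck.flipHom (k := k) (n := n) (m := m)).comp VonDyck.flipHom = MonoidHom.id _ := by
  apply VonDyck.hom_ext <;>
  simp only [MonoidHom.comp_apply, flipHom_s, flipHom_t, map_inv, inv_inv, MonoidHom.id_apply]

/-- The automorphism of the von Dyck group that inverts `s` and `t`. -/
def VonDyck.flip : MulAut (VonDyck k n m) :=
  MonoidHom.toMulEquiv VonDyck.flipHom VonDyck.flipHom VonDyck.flipHom_comp_self
    VonDyck.flipHom_comp_self

theorem VonDyck.flip_s : VonDyck.flip (VonDyck.mk k n m (J.s k n m)) =
    (VonDyck.mk k n m (J.s k n m))⁻¹ := VonDyck.flipHom_s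

theorem VonDyck.flip_t : VonDyck.flip (VonDyck.mk k n m (J.t k n m)) =
    (VonDyck.mk k n m (J.t k n m))⁻¹ := VonDyck.flipHom_t

theorem VonDyck.flip_mul_self : VonDyck.flip (k := k) (n := n) (m := m) * VonDyck.flip = 1 := by
  ext x
  exact DFunLike.congr_fun VonDyck.flipHom_comp_self x

/-- The Coxeter matrix of the group of the triangle with angles `π / k`, `π / n`, `π / m`,
the reflections being ordered so that their products have orders `k` (first two),
`n` (last two) and `m`. -/
def triangleMatrix (hk : k ≠ 1) (hn : n ≠ 1) (hm : m ≠ 1) : CoxeterMatrix (Fin 3) where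
  M := !![1, k, m; k, 1, n; m, n, 1]
  isSymm := by ext i j; fin_cases i <;> fin_cases j <;> rfl
  diagonal i := by fin_cases i <;> rfl
  off_diagonal i j h := by fin_cases i <;> fin_cases j <;> first | exact absurd rfl h | assumption

variable (hk : k ≠ 1) (hn : n ≠ 1) (hm : m ≠ 1)

/-- The Coxeter group of the triangle with angles `π / k`, `π / n`, `π / m`. -/
abbrev TriangleGroup : Type := (triangleMatrix hk hn hm).Group

/-- The simple reflections of the triangle group. -/
abbrev triangleReflection (i : Fin 3) : TriangleGroup hk hn hm :=
  (triangleMatrix hk hn hm).toCoxeterSystem.simple i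

theorem triangleReflection_mul_self (i : Fin 3) :
    triangleReflection hk hn hm i * triangleReflection hk hn hm i = 1 :=
  CoxeterSystem.simple_mul_simple_self _ i

theorem triangleReflection_pow (i j : Fin 3) :
    (triangleReflection hk hn hm i * triangleReflection hk hn hm j) ^
      triangleMatrix hk hn hm i j = 1 :=
  CoxeterSystem.simple_mul_simple_pow _ i j

/-- The homomorphism onto the group of rotations in the triangle group. -/
def toTriangleGroup : J k n m →* TriangleGroup hk hn hm :=
  J.lift (triangleReflection hk hn hm 0 * triangleReflection hk hn hm 1)
    (triangleReflection hk hn hm 1 * triangleReflection hk hn hm 2)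
    (triangleReflection hk hn hm 2 * triangleReflection hk hn hm 0)
    (triangleReflection_pow hk hn hm 0 1) (triangleReflection_pow hk hn hm 1 2)
    (triangleReflection_pow hk hn hm 2 0)
    (by simp [mul_assoc, CoxeterSystem.simple_mul_simple_cancel_left])
    (by simp [mul_assoc, CoxeterSystem.simple_mul_simple_cancel_left])

theorem toTriangleGroup_s : toTriangleGroup hk hn hm (J.s k n m) =
    triangleReflection hk hn hm 0 * triangleReflection hk hn hm 1 := by
  unfold toTriangleGroup; exact J.lift_s ..

theorem toTriangleGroup_t : toTriangleGroup hk hn hm (J.t k n m) =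
    triangleReflection hk hn hm 1 * triangleReflection hk hn hm 2 := by
  unfold toTriangleGroup; exact J.lift_t ..

theorem toTriangleGroup_u : toTriangleGroup hk hn hm (J.u k n m) =
    triangleReflection hk hn hm 2 * triangleReflection hk hn hm 0 := by
  unfold toTriangleGroup; exact J.lift_u ..

/-- The holomorph of the von Dyck group. -/
abbrev VonDyck.Hol (k n m : ℕ) : Type :=
  VonDyck k n m ⋊[MonoidHom.id (MulAut (VonDyck k n m))] MulAut (VonDyck k n m)

/-- Three involutions in the holomorph whose products are `s`, `t`, `u`. -/
def VonDyck.reflection (k n m : ℕ) : Fin 3 → VonDyck.Hol k n m :=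
  ![SemidirectProduct.inl (VonDyck.mk k n m (J.s k n m)) * SemidirectProduct.inr VonDyck.flip,
    SemidirectProduct.inr VonDyck.flip,
    SemidirectProduct.inr VonDyck.flip * SemidirectProduct.inl (VonDyck.mk k n m (J.t k n m))]

theorem VonDyck.inr_flip_mul_self :
    (SemidirectProduct.inr VonDyck.flip * SemidirectProduct.inr VonDyck.flip :
      VonDyck.Hol k n m) = 1 := by
  rw [← map_mul, VonDyck.flip_mul_self, map_one]

theorem VonDyck.inr_flip_mul_inl_mul (x : VonDyck k n m) :
    (SemidirectProduct.inr VonDyck.flip * SemidirectProduct.inl x *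
      SemidirectProduct.inr VonDyck.flip : VonDyck.Hol k n m) =
      SemidirectProduct.inl (VonDyck.flip x) := by
  have h : (SemidirectProduct.inr VonDyck.flip : VonDyck.Hol k n m)⁻¹ =
      SemidirectProduct.inr VonDyck.flip := by
    rw [inv_eq_iff_mul_eq_one, VonDyck.inr_flip_mul_self]
  have := SemidirectProduct.inl_aut (φ := MonoidHom.id (MulAut (VonDyck k n m))) VonDyck.flip x
  rw [map_inv, h] at this
  exact this.symm

theorem VonDyck.reflection_mul_self (i : Fin 3) :
    VonDyck.reflection k n m i * VonDyck.reflection k n m i = 1 := by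
  obtain rfl | rfl | rfl : i = 0 ∨ i = 1 ∨ i = 2 := by revert i; decide
  · simp only [VonDyck.reflection, Matrix.cons_val]
    rw [mul_assoc, ← mul_assoc (SemidirectProduct.inr _), VonDyck.inr_flip_mul_inl_mul,
      VonDyck.flip_s, ← map_mul, mul_inv_cancel, map_one]
  · exact VonDyck.inr_flip_mul_self
  · simp only [VonDyck.reflection, Matrix.cons_val]
    rw [← mul_assoc, VonDyck.inr_flip_mul_inl_mul, VonDyck.flip_t, ← map_mul, inv_mul_cancel,
      map_one]

theorem VonDyck.reflection_zero_one : VonDyck.reflection k n m 0 * VonDyck.reflection k n m 1 =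
    SemidirectProduct.inl (VonDyck.mk k n m (J.s k n m)) := by
  simp only [VonDyck.reflection, Matrix.cons_val]
  rw [mul_assoc, VonDyck.inr_flip_mul_self, mul_one]

theorem VonDyck.reflection_one_two : VonDyck.reflection k n m 1 * VonDyck.reflection k n m 2 =
    SemidirectProduct.inl (VonDyck.mk k n m (J.t k n m)) := by
  simp only [VonDyck.reflection, Matrix.cons_val]
  rw [← mul_assoc, VonDyck.inr_flip_mul_self, one_mul]

theorem VonDyck.reflection_two_zero : VonDyck.reflection k n m 2 * VonDyck.reflection k n m 0 =
    SemidirectProduct.inl (VonDyck.mk k n m (J.u k n m)) := by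
  simp only [VonDyck.reflection, Matrix.cons_val]
  rw [← mul_assoc, mul_assoc (SemidirectProduct.inr _), ← map_mul, VonDyck.inr_flip_mul_inl_mul,
    map_mul, VonDyck.flip_s, VonDyck.flip_t, ← mul_inv_rev, VonDyck.mk_u]

theorem VonDyck.reflection_isLiftable :
    (triangleMatrix hk hn hm).IsLiftable (VonDyck.reflection k n m) := by
  have hs : (VonDyck.reflection k n m 0 * VonDyck.reflection k n m 1) ^ k = 1 := by
    rw [VonDyck.reflection_zero_one, ← map_pow, ← map_pow, J.s_pow, map_one, map_one]
  have ht : (VonDyck.reflection k n m 1 * VonDyck.reflection k n m 2) ^ n = 1 := by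
    rw [VonDyck.reflection_one_two, ← map_pow, ← map_pow, J.t_pow, map_one, map_one]
  have hu : (VonDyck.reflection k n m 2 * VonDyck.reflection k n m 0) ^ m = 1 := by
    rw [VonDyck.reflection_two_zero, ← map_pow, ← map_pow, J.u_pow, map_one, map_one]
  have hinv (i : Fin 3) : (VonDyck.reflection k n m i)⁻¹ = VonDyck.reflection k n m i :=
    inv_eq_of_mul_eq_one_left (VonDyck.reflection_mul_self i)
  have hswap {i j : Fin 3} {a : ℕ}
      (h : (VonDyck.reflection k n m i * VonDyck.reflection k n m j) ^ a = 1) :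
      (VonDyck.reflection k n m j * VonDyck.reflection k n m i) ^ a = 1 := by
    rw [← inv_eq_one, ← inv_pow, mul_inv_rev, hinv, hinv] at h
    exact h
  have hself (i : Fin 3) :
      (VonDyck.reflection k n m i * VonDyck.reflection k n m i) ^ 1 = 1 := by
    rw [pow_one, VonDyck.reflection_mul_self]
  intro i j
  obtain rfl | rfl | rfl : i = 0 ∨ i = 1 ∨ i = 2 := by revert i; decide
  all_goals obtain rfl | rfl | rfl : j = 0 ∨ j = 1 ∨ j = 2 := by revert j; decide
  exacts [hself 0, hs, hswap hu, hswap hs, hself 1, ht, hu, hswap ht, hself 2]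

/-- The homomorphism from the triangle group that recovers the von Dyck group from the
rotations. -/
def triangleGroupToHol : TriangleGroup hk hn hm →* VonDyck.Hol k n m :=
  (triangleMatrix hk hn hm).toCoxeterSystem.lift
    ⟨VonDyck.reflection k n m, VonDyck.reflection_isLiftable hk hn hm⟩

theorem triangleGroupToHol_reflection (i : Fin 3) :
    triangleGroupToHol hk hn hm (triangleReflection hk hn hm i) = VonDyck.reflection k n m i :=
  CoxeterSystem.lift_apply_simple _ _ i

/-- The map from the triangle group to the holomorph undoes `toTriangleGroup` up to the quotient by
⟨stu⟩, and `SemidirectProduct.inl` is injective. -/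
theorem mem_zpowers_of_toTriangleGroup_eq_one {g : J k n m} (h : toTriangleGroup hk hn hm g = 1) :
    g ∈ Subgroup.zpowers (J.z k n m) := by
  have hcomp : (triangleGroupToHol hk hn hm).comp (toTriangleGroup hk hn hm) =
      SemidirectProduct.inl.comp (VonDyck.mk k n m) := by
    apply J.hom_ext <;>
    simp only [MonoidHom.comp_apply, toTriangleGroup_s, toTriangleGroup_t, toTriangleGroup_u,
      map_mul (triangleGroupToHol hk hn hm), triangleGroupToHol_reflection,
      VonDyck.reflection_zero_one, VonDyck.reflection_one_two, VonDyck.reflection_two_zero]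
  have hg := DFunLike.congr_fun hcomp g
  rw [MonoidHom.comp_apply, h, map_one, MonoidHom.comp_apply, eq_comm,
    ← map_one SemidirectProduct.inl, SemidirectProduct.inl_inj] at hg
  exact (QuotientGroup.eq_one_iff g).mp hg

theorem det_toTriangleGroup (g : J k n m) : LinearMap.det
    ((triangleMatrix hk hn hm).toCoxeterSystem.geometricRep (toTriangleGroup hk hn hm g)) = 1 := by
  have h2 (i j : Fin 3) : LinearMap.det ((triangleMatrix hk hn hm).toCoxeterSystem.geometricRep
      (triangleReflection hk hn hm i * triangleReflection hk hn hm j)) = 1 := by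
    rw [map_mul, map_mul, CoxeterSystem.geometricRep_simple, CoxeterSystem.geometricRep_simple,
      CoxeterSystem.det_rootReflection, CoxeterSystem.det_rootReflection]
    norm_num
  -- Passing to units turns the determinant into a group homomorphism, whose kernel is a subgroup
  -- and can be tested on generators.
  have h : (LinearMap.det.comp (((triangleMatrix hk hn hm).toCoxeterSystem.geometricRep).comp
      (toTriangleGroup hk hn hm))).toHomUnits.ker = ⊤ := by
    apply J.induction_on <;> rw [MonoidHom.mem_ker, Units.ext_iff, MonoidHom.coe_toHomUnits,
      MonoidHom.comp_apply, MonoidHom.comp_apply, Units.val_one]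
    · rw [toTriangleGroup_s, h2]
    · rw [toTriangleGroup_t, h2]
    · rw [toTriangleGroup_u, h2]
  have hg : g ∈ (LinearMap.det.comp (((triangleMatrix hk hn hm).toCoxeterSystem.geometricRep).comp
      (toTriangleGroup hk hn hm))).toHomUnits.ker := h ▸ Subgroup.mem_top g
  exact congrArg Units.val (MonoidHom.mem_ker.mp hg)

/-- The center of `J(k, n, m)` is generated by `stu`, if at most one of `k`, `n`, `m` is `2`. -/
theorem center_J_of_not_dihedral (hk : k ≠ 1) (hn : n ≠ 1) (hm : m ≠ 1)
    (h : (k ≠ 2 ∧ n ≠ 2) ∨ (n ≠ 2 ∧ m ≠ 2) ∨ (k ≠ 2 ∧ m ≠ 2)) :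
    Subgroup.center (J k n m) = Subgroup.zpowers (J.z k n m) := by
  refine le_antisymm (fun g hg => ?_) (Subgroup.zpowers_le.mpr J.z_mem_center)
  apply mem_zpowers_of_toTriangleGroup_eq_one hk hn hm
  set w := toTriangleGroup hk hn hm g with hw
  have hcomm (x : J k n m) : Commute w (toTriangleGroup hk hn hm x) :=
    (show Commute g x from (Subgroup.mem_center_iff.mp hg x).symm).map _
  have hinv (i : Fin 3) : (triangleReflection hk hn hm i)⁻¹ = triangleReflection hk hn hm i :=
    inv_eq_of_mul_eq_one_left (triangleReflection_mul_self hk hn hm i)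
  have hswap {i j : Fin 3}
      (h : Commute w (triangleReflection hk hn hm i * triangleReflection hk hn hm j)) :
      Commute w (triangleReflection hk hn hm j * triangleReflection hk hn hm i) := by
    have := h.inv_right
    rwa [mul_inv_rev, hinv, hinv] at this
  have hself (i : Fin 3) :
      Commute w (triangleReflection hk hn hm i * triangleReflection hk hn hm i) := by
    rw [triangleReflection_mul_self]; exact Commute.one_right w
  have hs := toTriangleGroup_s hk hn hm ▸ hcomm (J.s k n m)
  have ht := toTriangleGroup_t hk hn hm ▸ hcomm (J.t k n m)
  have hu := toTriangleGroup_u hk hn hm ▸ hcomm (J.u k n m)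
  refine CoxeterSystem.eq_one_of_commute_rotations _ ?_ (det_toTriangleGroup hk hn hm g) ?_
  -- The chosen vertex of the diagram is the one shared by the two edges with labels different from
  -- 2.
  · rcases h with h | h | h
    · refine ⟨1, fun j hj => ?_⟩
      obtain rfl | rfl : j = 0 ∨ j = 2 := by revert j; decide
      exacts [h.1, h.2]
    · refine ⟨2, fun j hj => ?_⟩
      obtain rfl | rfl : j = 0 ∨ j = 1 := by revert j; decide
      exacts [h.2, h.1]
    · refine ⟨0, fun j hj => ?_⟩
      obtain rfl | rfl : j = 1 ∨ j = 2 := by revert j; decide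
      exacts [h.1, h.2]
  · intro i j
    obtain rfl | rfl | rfl : i = 0 ∨ i = 1 ∨ i = 2 := by revert i; decide
    all_goals obtain rfl | rfl | rfl : j = 0 ∨ j = 1 ∨ j = 2 := by revert j; decide
    exacts [hself 0, hs, hswap hu, hswap hs, hself 1, ht, hu, hswap ht, hself 2]

end VonDyck

/-! ### The center of J when two parameters equal 2 -/

section Dihedral

variable {N : ℕ}

/-- The translation by `d` on the first of two copies of `ZMod N`. -/
def dihedralTranslation (d : ZMod N) : Equiv.Perm (ZMod N × Bool) where
  toFun x := (bif x.2 then x.1 else x.1 + d, x.2)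
  invFun x := (bif x.2 then x.1 else x.1 - d, x.2)
  left_inv := by rintro ⟨x, _ | _⟩ <;> simp
  right_inv := by rintro ⟨x, _ | _⟩ <;> simp

/-- The translations on the first of two copies of `ZMod N`, as a homomorphism. -/
def dihedralTranslationHom : Multiplicative (ZMod N) →* Equiv.Perm (ZMod N × Bool) where
  toFun d := dihedralTranslation d.toAdd
  map_one' := by ext ⟨x, _ | _⟩ <;> simp [dihedralTranslation]
  map_mul' d e := by
    ext ⟨x, _ | _⟩ <;> simp [dihedralTranslation]; ring

/-- The permutation exchanging two copies of `ZMod N`, with a shift by `d`. -/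
def dihedralSwap (d : ZMod N) : Equiv.Perm (ZMod N × Bool) where
  toFun x := (bif x.2 then x.1 + d else x.1 - d, !x.2)
  invFun x := (bif x.2 then x.1 + d else x.1 - d, !x.2)
  left_inv := by rintro ⟨x, _ | _⟩ <;> simp
  right_inv := by rintro ⟨x, _ | _⟩ <;> simp

theorem dihedralTranslation_zpow (d : ZMod N) (j : ℤ) :
    dihedralTranslation d ^ j = dihedralTranslation ((j : ZMod N) * d) := by
  have := map_zpow dihedralTranslationHom (Multiplicative.ofAdd d) j
  rw [← ofAdd_zsmul, zsmul_eq_mul] at this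
  exact this.symm

theorem dihedralTranslation_pow (d : ZMod N) (j : ℕ) :
    dihedralTranslation d ^ j = dihedralTranslation ((j : ZMod N) * d) := by
  have := dihedralTranslation_zpow d j
  rwa [zpow_natCast, Int.cast_natCast] at this

theorem dihedralTranslation_zero : dihedralTranslation (0 : ZMod N) = 1 := by
  ext ⟨x, _ | _⟩ <;> simp [dihedralTranslation]

theorem dihedralSwap_sq (d : ZMod N) : dihedralSwap d ^ 2 = 1 := by
  rw [sq]; ext ⟨x, _ | _⟩ <;> simp [dihedralSwap]

theorem dihedral_rel₁ : dihedralSwap (0 : ZMod N) * dihedralSwap 1 * dihedralTranslation 2 =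
    dihedralSwap 1 * dihedralTranslation 2 * dihedralSwap 0 := by
  ext ⟨x, _ | _⟩ <;> simp [dihedralSwap, dihedralTranslation] <;> ring

theorem dihedral_rel₂ : dihedralSwap (1 : ZMod N) * dihedralTranslation 2 * dihedralSwap 0 =
    dihedralTranslation 2 * dihedralSwap 0 * dihedralSwap 1 := by
  ext ⟨x, _ | _⟩ <;> simp [dihedralSwap, dihedralTranslation] <;> ring

theorem dihedralTranslation_two_pow {p : ℕ} :
    dihedralTranslation (2 : ZMod (2 * p)) ^ p = 1 := by
  rw [dihedralTranslation_pow, show (p : ZMod (2 * p)) * 2 = ((2 * p : ℕ) : ZMod (2 * p)) by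
    push_cast; ring, ZMod.natCast_self, dihedralTranslation_zero]

/-- The center of `J(2, 2, p)`, where the three generators are only known up to a cyclic
permutation. -/
theorem center_le_zpowers_of_dihedral {G : Type*} [Group G] {p : ℕ} (hp : 2 ≤ p) {a b c z : G}
    (hgen : Subgroup.closure {a, b, c} = ⊤) (ha : a ^ 2 = 1) (hb : b ^ 2 = 1) (hc : c ^ p = 1)
    (hz : z = a * b * c) (hzc : z ∈ Subgroup.center G)
    (f : G →* Equiv.Perm (ZMod (2 * p) × Bool)) (hfa : f a = dihedralSwap 0)
    (hfc : f c = dihedralTranslation 2) : Subgroup.center G ≤ Subgroup.zpowers z := by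
  have zc (g : G) : Commute z g := (Subgroup.mem_center_iff.mp hzc g).symm
  have ha1 : a⁻¹ = a := inv_eq_of_mul_eq_one_left (by rw [← sq, ha])
  have hb1 : b⁻¹ = b := inv_eq_of_mul_eq_one_left (by rw [← sq, hb])
  have hbz : b = z * (a * c⁻¹) := by
    calc b = a⁻¹ * z * c⁻¹ := by rw [hz]; group
      _ = _ := by rw [ha1, ← (zc a).eq]; group
  have hca : c * a = z ^ 2 * (a * c⁻¹) := by
    calc c * a = (a * c⁻¹)⁻¹ := by rw [mul_inv_rev, ha1, inv_inv]
      _ = (z⁻¹ * b)⁻¹ := by rw [hbz]; group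
      _ = b * z := by rw [mul_inv_rev, hb1, inv_inv]
      _ = _ := by rw [← (zc b).eq, hbz, sq]; group
  have hca' : c⁻¹ * a = z ^ (-2 : ℤ) * (a * c) := by
    calc c⁻¹ * a = (a * c)⁻¹ := by rw [mul_inv_rev, ha1]
      _ = (c⁻¹ * (c * a) * c)⁻¹ := by group
      _ = (c⁻¹ * z ^ 2 * a)⁻¹ := by rw [hca]; group
      _ = (z ^ 2 * (c⁻¹ * a))⁻¹ := by rw [← ((zc c⁻¹).pow_left 2).eq]; group
      _ = a * c * z ^ (-2 : ℤ) := by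
        rw [mul_inv_rev, mul_inv_rev, ha1, inv_inv]; group
      _ = _ := (((zc (a * c)).zpow_left (-2)).eq).symm
  -- Normal forms: b = z a c⁻¹ eliminates b, and c^{±1} a = z^{±2} a c^{∓1} moves powers of c to the
  -- right of a.
  let S : Set G := {g | ∃ j l : ℤ, g = z ^ l * c ^ j ∨ g = z ^ l * (a * c ^ j)}
  have hSz (l : ℤ) {g : G} (hg : g ∈ S) : z ^ l * g ∈ S := by
    obtain ⟨j, l', rfl | rfl⟩ := hg
    · exact ⟨j, l + l', Or.inl (by rw [zpow_add]; group)⟩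
    · exact ⟨j, l + l', Or.inr (by rw [zpow_add]; group)⟩
  have hSa {g : G} (hg : g ∈ S) : a * g ∈ S := by
    obtain ⟨j, l, rfl | rfl⟩ := hg
    · exact ⟨j, l, Or.inr (by rw [← mul_assoc, ← ((zc a).zpow_left l).eq, mul_assoc])⟩
    · refine ⟨j, l, Or.inl ?_⟩
      rw [← mul_assoc, ← ((zc a).zpow_left l).eq, mul_assoc, ← mul_assoc a, ← sq, ha, one_mul]
  have hSc (e : ℤ) (he : c ^ e * a = z ^ (2 * e) * (a * c ^ (-e))) {g : G} (hg : g ∈ S) :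
      c ^ e * g ∈ S := by
    obtain ⟨j, l, rfl | rfl⟩ := hg
    · refine ⟨e + j, l, Or.inl ?_⟩
      rw [← mul_assoc, ← ((zc (c ^ e)).zpow_left l).eq, mul_assoc, zpow_add]
    · refine ⟨-e + j, l + 2 * e, Or.inr ?_⟩
      rw [← mul_assoc, ← ((zc (c ^ e)).zpow_left l).eq, mul_assoc, ← mul_assoc (c ^ e), he,
        zpow_add, zpow_add]
      group
  have hSc1 {g : G} (hg : g ∈ S) : c * g ∈ S := by
    have := hSc 1 (by simpa using hca) hg
    rwa [zpow_one] at this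
  have hSc2 {g : G} (hg : g ∈ S) : c⁻¹ * g ∈ S := by
    have := hSc (-1) (by simpa using hca') hg
    rwa [zpow_neg_one] at this
  -- Stabilizer of S under left multiplication; the equivalence, rather than an implication, makes
  -- it closed under inverses.
  let K : Subgroup G :=
    { carrier := {h | ∀ g, h * g ∈ S ↔ g ∈ S}
      one_mem' := fun g => by rw [one_mul]
      mul_mem' := fun {x y} hx hy g => by rw [mul_assoc, hx, hy]
      inv_mem' := fun {x} hx g => by rw [← hx, mul_inv_cancel_left] }
  have hKa : a ∈ K := fun g => ⟨fun h => by
    have := hSa h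
    rwa [← mul_assoc, ← sq, ha, one_mul] at this, hSa⟩
  have hKc : c ∈ K := fun g => ⟨fun h => by
    have := hSc2 h
    rwa [inv_mul_cancel_left] at this, hSc1⟩
  have hKz : z ∈ K := fun g => ⟨fun h => by
    have := hSz (-1) h
    rwa [zpow_neg_one, inv_mul_cancel_left] at this, fun h => by
    have := hSz 1 h
    rwa [zpow_one] at this⟩
  have hK : K = ⊤ := by
    rw [eq_top_iff, ← hgen, Subgroup.closure_le]
    rintro x (rfl | rfl | rfl)
    · exact hKa
    · rw [hbz]
      exact K.mul_mem hKz (K.mul_mem hKa (K.inv_mem hKc))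
    · exact hKc
  intro g hg
  have hgK : g ∈ K := hK ▸ Subgroup.mem_top g
  have h1 : (1 : G) ∈ S := ⟨0, 0, Or.inl (by simp)⟩
  have hgS : g ∈ S := by
    have := (hgK 1).mpr h1
    rwa [mul_one] at this
  obtain ⟨j, l, rfl | rfl⟩ := hgS
  -- Here c translates one copy of `ZMod (2 * p)` by 2 and a exchanges the copies, so commuting
  -- forces 2j = 0 modulo 2p, hence c^j = 1.
  · have hcj : c ^ j * a = a * c ^ j := by
      have := Subgroup.mem_center_iff.mp hg a
      rw [← mul_assoc, ← ((zc a).zpow_left l).eq, mul_assoc, mul_assoc] at this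
      exact (mul_left_cancel this).symm
    have h := congrArg (fun x => (f x (0, false)).1) hcj
    simp only [map_mul, map_zpow, hfa, hfc, dihedralTranslation_zpow] at h
    simp only [dihedralSwap, dihedralTranslation, Equiv.Perm.coe_mul, Function.comp_apply,
      Equiv.coe_fn_mk] at h
    have h0 : ((j * 2 : ℤ) : ZMod (2 * p)) = 0 := by
      push_cast; simpa using h.symm
    rw [ZMod.intCast_zmod_eq_zero_iff_dvd] at h0
    have hpj : (p : ℤ) ∣ j := by
      push_cast at h0
      rw [mul_comm j] at h0
      exact Int.dvd_of_mul_dvd_mul_left two_ne_zero h0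
    obtain ⟨e, rfl⟩ := hpj
    rw [zpow_mul, zpow_natCast, hc, one_zpow, mul_one]
    exact Subgroup.zpow_mem_zpowers z l
  · exfalso
    -- The two sides move the point (0, false) to points whose coordinates differ by 2, which is
    -- nonzero modulo 2p because p ≥ 2.
    have hcj : a * c ^ j * c = c * (a * c ^ j) := by
      have := Subgroup.mem_center_iff.mp hg c
      rw [← mul_assoc c, ← ((zc c).zpow_left l).eq, mul_assoc, mul_assoc] at this
      exact (mul_left_cancel this).symm
    have h := congrArg (fun x => (f x (0, false)).1) hcj
    simp only [map_mul, map_zpow, hfa, hfc, dihedralTranslation_zpow] at h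
    simp only [dihedralSwap, dihedralTranslation, Equiv.Perm.coe_mul, Function.comp_apply,
      Equiv.coe_fn_mk] at h
    have h0 : ((2 : ℕ) : ZMod (2 * p)) = 0 := by simpa using h
    rw [ZMod.natCast_eq_zero_iff] at h0
    have := Nat.le_of_dvd two_pos h0
    omega

variable {k n m : ℕ}

theorem J.closure_eq_top {a b c : J k n m} (hs : J.s k n m ∈ ({a, b, c} : Set (J k n m)))
    (ht : J.t k n m ∈ ({a, b, c} : Set (J k n m)))
    (hu : J.u k n m ∈ ({a, b, c} : Set (J k n m))) : Subgroup.closure {a, b, c} = ⊤ :=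
  J.induction_on (Subgroup.subset_closure hs) (Subgroup.subset_closure ht)
    (Subgroup.subset_closure hu)

/-- The center of `J(k, n, m)` is generated by `stu`. -/
theorem center_J (hk : 2 ≤ k) (hn : 2 ≤ n) (hm : 2 ≤ m) :
    Subgroup.center (J k n m) = Subgroup.zpowers (J.z k n m) := by
  by_cases h : (k ≠ 2 ∧ n ≠ 2) ∨ (n ≠ 2 ∧ m ≠ 2) ∨ (k ≠ 2 ∧ m ≠ 2)
  · exact center_J_of_not_dihedral (by omega) (by omega) (by omega) h
  refine le_antisymm ?_ (Subgroup.zpowers_le.mpr J.z_mem_center)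
  -- The relations of J are invariant under cyclic permutation of s, t, u, so the remaining
  -- parameter can play the role of p.
  rcases (show (k = 2 ∧ n = 2) ∨ (n = 2 ∧ m = 2) ∨ (k = 2 ∧ m = 2) by omega) with
    ⟨rfl, rfl⟩ | ⟨rfl, rfl⟩ | ⟨rfl, rfl⟩
  · exact center_le_zpowers_of_dihedral hm (a := J.s _ _ _) (b := J.t _ _ _) (c := J.u _ _ _)
      (J.closure_eq_top (by simp) (by simp) (by simp)) (J.s_pow ..) (J.t_pow ..) (J.u_pow ..) rfl
      J.z_mem_center
      (J.lift (dihedralSwap 0) (dihedralSwap 1) (dihedralTranslation 2) (dihedralSwap_sq _)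
        (dihedralSwap_sq _) dihedralTranslation_two_pow dihedral_rel₁ dihedral_rel₂)
      (J.lift_s ..) (J.lift_u ..)
  · exact center_le_zpowers_of_dihedral hk (a := J.t _ _ _) (b := J.u _ _ _) (c := J.s _ _ _)
      (J.closure_eq_top (by simp) (by simp) (by simp)) (J.t_pow ..) (J.u_pow ..) (J.s_pow ..)
      (J.rel₁ ..) J.z_mem_center
      (J.lift (dihedralTranslation 2) (dihedralSwap 0) (dihedralSwap 1)
        dihedralTranslation_two_pow (dihedralSwap_sq _) (dihedralSwap_sq _)
        (dihedral_rel₁.trans dihedral_rel₂).symm dihedral_rel₁)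
      (J.lift_t ..) (J.lift_s ..)
  · exact center_le_zpowers_of_dihedral hn (a := J.u _ _ _) (b := J.s _ _ _) (c := J.t _ _ _)
      (J.closure_eq_top (by simp) (by simp) (by simp)) (J.u_pow ..) (J.s_pow ..) (J.t_pow ..)
      ((J.rel₁ ..).trans (J.rel₂ ..)) J.z_mem_center
      (J.lift (dihedralSwap 1) (dihedralTranslation 2) (dihedralSwap 0) (dihedralSwap_sq _)
        dihedralTranslation_two_pow (dihedralSwap_sq _) dihedral_rel₂
        (dihedral_rel₁.trans dihedral_rel₂).symm)
      (J.lift_u ..) (J.lift_t ..)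

end Dihedral

/-! ### Braid systems: the relations on an infinite sequence -/

section BraidSystem

variable {G : Type*} [Group G]

/-- The product `X_0 X_1 ⋯ X_{j-1}` of the first `j` terms of a sequence. -/
def seqProd (X : ℕ → G) : ℕ → G
  | 0 => 1
  | j + 1 => seqProd X j * X j

theorem seqProd_add (X : ℕ → G) (i j : ℕ) :
    seqProd X (i + j) = seqProd X i * seqProd (fun l => X (i + l)) j := by
  induction j with
  | zero => simp [seqProd]
  | succ j ih => rw [← add_assoc, seqProd, seqProd, ih, mul_assoc]

theorem seqProd_semiconj {X Y : ℕ → G} {g : G} (h : ∀ i, g * X i = Y i * g) (j : ℕ) :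
    g * seqProd X j = seqProd Y j * g := by
  induction j with
  | zero => simp [seqProd]
  | succ j ih => rw [seqProd, seqProd, ← mul_assoc, ih, mul_assoc, h, mul_assoc]

theorem seqProd_conj (s t : G) (j : ℕ) :
    seqProd (fun i => t ^ i * s * (t ^ i)⁻¹) j = (s * t) ^ j * (t ^ j)⁻¹ := by
  induction j with
  | zero => simp [seqProd]
  | succ j ih => rw [seqProd, ih, pow_succ, pow_succ t]; group

theorem map_seqProd {H : Type*} [Group H] (f : G →* H) (X : ℕ → G) (j : ℕ) :
    f (seqProd X j) = seqProd (fun i => f (X i)) j := by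
  induction j with
  | zero => simp [seqProd]
  | succ j ih => simp [seqProd, ih]

theorem pow_mul_eq_of_shift {X : ℕ → G} {g : G} {a : ℕ} (h : ∀ i, g * X i = X (i + a) * g)
    (j i : ℕ) : g ^ j * X i = X (i + j * a) * g ^ j := by
  induction j with
  | zero => simp
  | succ j ih =>
    rw [pow_succ', mul_assoc, ih, ← mul_assoc, h, mul_assoc, ← pow_succ', add_assoc, Nat.succ_mul]

/-- The relations of the braid group in terms of an infinite sequence of conjugates of the
generators `x_1, …, x_n`, indexed by `0, 1, 2, …`. -/
structure IsBraidSystem (n m : ℕ) (X : ℕ → G) (y z : G) : Prop where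
  shift (i : ℕ) : y * X i = X (i + n) * y
  rot (i : ℕ) : z * seqProd X m * X (i + m) = X i * (z * seqProd X m)
  comm_y : Commute y (z * seqProd X m)
  comm_z : Commute (seqProd X n * y) z

namespace IsBraidSystem

variable {n m : ℕ} {X : ℕ → G} {y z : G}

theorem delta_pow (h : IsBraidSystem n m X y z) (j : ℕ) :
    (seqProd X n * y) ^ j = seqProd X (n * j) * y ^ j := by
  induction j with
  | zero => simp [seqProd]
  | succ j ih =>
    rw [pow_succ', ih, mul_add, mul_one, add_comm (n * j), seqProd_add, pow_succ']
    have := seqProd_semiconj (X := X) (Y := fun l => X (n + l)) (g := y)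
      (fun i => by rw [h.shift, add_comm]) (n * j)
    calc _ = seqProd X n * (y * seqProd X (n * j)) * y ^ j := by group
      _ = _ := by rw [this]; group

theorem rotation_pow (h : IsBraidSystem n m X y z) (j : ℕ) :
    (z * seqProd X m) ^ j = z ^ j * seqProd X (m * j) := by
  induction j with
  | zero => simp [seqProd]
  | succ j ih =>
    rw [pow_succ, ih, mul_add, mul_one, add_comm (m * j), seqProd_add, pow_succ]
    have := seqProd_semiconj (X := fun l => X (m + l)) (Y := X) (g := z * seqProd X m)
      (fun i => by rw [add_comm, h.rot]) (m * j)
    calc _ = z ^ j * (seqProd X (m * j) * (z * seqProd X m)) := by group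
      _ = _ := by rw [← this]; group

/-- Both sides telescope to z^n X_0⋯X_{nm-1} y^m. -/
theorem garside_eq (h : IsBraidSystem n m X y z) :
    (z * seqProd X m) ^ n * y ^ m = (seqProd X n * y) ^ m * z ^ n := by
  rw [((h.comm_z.pow_left m).pow_right n).eq, h.delta_pow, h.rotation_pow, mul_comm m n, mul_assoc]

theorem rotation_pow_mul (h : IsBraidSystem n m X y z) (j i : ℕ) :
    (z * seqProd X m) ^ j * X (i + j * m) = X i * (z * seqProd X m) ^ j := by
  induction j generalizing i with
  | zero => simp
  | succ j ih =>
    rw [pow_succ, mul_assoc, show i + (j + 1) * m = (i + j * m) + m by ring, h.rot, ← mul_assoc, ih,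
      mul_assoc]

/-- Conjugation by y^m raises the index by mn, and conjugation by the n-th power of the rotation
lowers it by the same amount. -/
theorem garside_commute_X (h : IsBraidSystem n m X y z) (i : ℕ) :
    Commute ((z * seqProd X m) ^ n * y ^ m) (X i) := by
  change _ * _ = _ * _
  rw [mul_assoc, pow_mul_eq_of_shift h.shift, mul_comm m n, ← mul_assoc, h.rotation_pow_mul,
    mul_assoc]

theorem garside_commute_y (h : IsBraidSystem n m X y z) :
    Commute ((z * seqProd X m) ^ n * y ^ m) y :=
  (h.comm_y.symm.pow_left n).mul_left ((Commute.refl y).pow_left m)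

theorem garside_commute_z (h : IsBraidSystem n m X y z) :
    Commute ((z * seqProd X m) ^ n * y ^ m) z := by
  have h1 : Commute ((z * seqProd X m) ^ n * y ^ m) (z * seqProd X m) :=
    ((Commute.refl _).pow_left n).mul_left (h.comm_y.pow_left m)
  have h2 : Commute ((z * seqProd X m) ^ n * y ^ m) (seqProd X m) :=
    seqProd_semiconj (fun i => h.garside_commute_X i) m
  have := h1.mul_right h2.inv_right
  rwa [mul_inv_cancel_right] at this

theorem map {H : Type*} [Group H] (h : IsBraidSystem n m X y z) (f : G →* H) :
    IsBraidSystem n m (fun i => f (X i)) (f y) (f z) := by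
  have hP (j : ℕ) : seqProd (fun i => f (X i)) j = f (seqProd X j) := (map_seqProd f X j).symm
  refine ⟨fun i => ?_, fun i => ?_, ?_, ?_⟩
  · rw [← map_mul, h.shift, map_mul]
  · rw [hP, ← map_mul, ← map_mul, h.rot, map_mul]
  · rw [hP, ← map_mul]; exact h.comm_y.map f
  · rw [hP, ← map_mul]; exact h.comm_z.map f

/-- When the Garside element is trivial, the braid system comes from two elements `t` and
`s = X_0` with `y = t^n` and `z = u^m` for `u = (st)⁻¹`. -/
theorem exists_root (h : IsBraidSystem n m X y z) (hn : n ≠ 0) (hm : m ≠ 0)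
    (hnm : Nat.Coprime n m) (hΔ : (z * seqProd X m) ^ n * y ^ m = 1) :
    ∃ t : G, t ^ n = y ∧ (∀ i, X i = t ^ i * X 0 * (t ^ i)⁻¹) ∧ (X 0 * t)⁻¹ ^ m = z := by
  -- Bézout with natural coefficients. The case n = 1 is separate because no residue modulo 1 equals
  -- the number 1.
  obtain ⟨β, a, hβ⟩ : ∃ β a : ℕ, β * m = 1 + a * n := by
    rcases eq_or_ne n 1 with rfl | hn1
    · exact ⟨1, m - 1, by omega⟩
    · obtain ⟨β, -, hβ⟩ := Nat.exists_mul_mod_eq_one_of_coprime hnm.symm (by omega)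
      exact ⟨β, m * β / n, by rw [← hβ, mul_comm, mul_comm (m * β / n), Nat.mod_add_div]⟩
  obtain ⟨v, hv⟩ : ∃ v, v = z * seqProd X m := ⟨_, rfl⟩
  have hyv : Commute v y := hv ▸ h.comm_y.symm
  have hvy : Commute (v ^ β) (y ^ a) := (hyv.pow_left β).pow_right a
  rw [← hv] at hΔ
  have hvn : v ^ n = (y ^ m)⁻¹ := eq_inv_of_mul_eq_one_left hΔ
  -- Conjugation by v^β y^a lowers indices by βm - an = 1, so t raises them by 1. Since v^n =
  -- y^{-m}, the same identity gives t^n = y and t^{-m} = v.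
  obtain ⟨t, ht⟩ : ∃ t, t = (v ^ β * y ^ a)⁻¹ := ⟨_, rfl⟩
  have htn : t ^ n = y := by
    rw [ht, inv_pow, hvy.mul_pow, ← pow_mul, mul_comm β, pow_mul, hvn, ← pow_mul, inv_pow,
      ← pow_mul, mul_comm m, hβ, pow_add, pow_one]
    group
  have htm : (t ^ m)⁻¹ = v := by
    rw [ht, inv_pow, inv_inv, hvy.mul_pow, ← pow_mul, hβ, ← pow_mul, pow_add, pow_one,
      mul_comm a n, pow_mul, hvn, inv_pow, ← pow_mul, mul_comm m a, inv_mul_cancel_right]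
  have hstep (i : ℕ) : X (i + 1) = t * X i * t⁻¹ := by
    have h1 := pow_mul_eq_of_shift h.shift a (i + 1)
    have h2 := h.rotation_pow_mul β i
    rw [← hv, hβ] at h2
    have h3 : v ^ β * y ^ a * X (i + 1) = X i * (v ^ β * y ^ a) := by
      rw [mul_assoc, h1, ← mul_assoc, add_assoc, h2, mul_assoc]
    rw [ht, inv_inv, mul_assoc, ← h3, inv_mul_cancel_left]
  have hX (i : ℕ) : X i = t ^ i * X 0 * (t ^ i)⁻¹ := by
    induction i with
    | zero => simp
    | succ i ih => rw [hstep, ih, pow_succ']; group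
  refine ⟨t, htn, hX, ?_⟩
  -- Telescoping gives X_0⋯X_{m-1} = (X_0 t)^m t^{-m}; substituting into v = z X_0⋯X_{m-1} leaves z
  -- (X_0 t)^m = 1.
  have hP : seqProd X m = (X 0 * t) ^ m * v := by
    rw [← htm, ← seqProd_conj, ← funext hX]
  rw [hP, ← mul_assoc] at hv
  rw [inv_pow]
  exact (eq_inv_of_mul_eq_one_left (right_eq_mul.mp hv)).symm

end IsBraidSystem

/-! ### From the defining relations to a braid system -/

section Relations

variable {n m : ℕ}

/-- The sequence of conjugates of the generators, extending the tuple `(x_1, …, x_n)` in such a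
way that conjugation by `y` shifts the index by `n`. -/
def extendSeq (hn : n ≠ 0) (x : Fin n → G) (y : G) (i : ℕ) : G :=
  y ^ (i / n) * x ⟨i % n, Nat.mod_lt i (Nat.pos_of_ne_zero hn)⟩ * (y ^ (i / n))⁻¹

variable (hn : n ≠ 0) (x : Fin n → G) (y : G)

theorem extendSeq_of_lt {i : ℕ} (hi : i < n) : extendSeq hn x y i = x ⟨i, hi⟩ := by
  simp [extendSeq, Nat.div_eq_of_lt hi, Nat.mod_eq_of_lt hi]

theorem extendSeq_shift (i : ℕ) : y * extendSeq hn x y i = extendSeq hn x y (i + n) * y := by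
  simp only [extendSeq, Nat.add_div_right i (Nat.pos_of_ne_zero hn), Nat.add_mod_right, pow_succ']
  group

theorem seqProd_extendSeq {j : ℕ} (hj : j ≤ n) :
    seqProd (extendSeq hn x y) j = initialProd x j := by
  induction j with
  | zero => simp [seqProd, initialProd]
  | succ j ih =>
    rw [seqProd, ih (by omega), extendSeq_of_lt hn x y (show j < n by omega), initialProd,
      initialProd, List.prod_take_succ _ _ (by simpa using hj)]
    simp

theorem finalProd_eq {j : ℕ} (hj : j ≤ n) :
    finalProd x j = (seqProd (extendSeq hn x y) j)⁻¹ * seqProd (extendSeq hn x y) n := by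
  rw [seqProd_extendSeq hn x y hj, seqProd_extendSeq hn x y le_rfl, eq_inv_mul_iff_mul_eq]
  simp [initialProd, finalProd, List.take_of_length_le]

variable {x y} {z : G}

/-- The defining relations of the braid group, other than `y = 1` and `z = 1`, say that the
extended sequence is a braid system. -/
theorem isBraidSystem_extendSeq
    (h1 : initialProd x n * y * z = z * initialProd x n * y)
    (h2 : ∀ i, 1 ≤ i → i ≤ n - m % n →
      finalProd x i * y * z * deltaWord x y ^ (((m / n : ℕ) : ℤ) - 1) * initialProd x (i + m % n) =
      finalProd x (i - 1) * y * z * deltaWord x y ^ (((m / n : ℕ) : ℤ) - 1) *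
        initialProd x (i + m % n - 1))
    (h3 : ∀ i, n - m % n + 1 ≤ i → i ≤ n →
      finalProd x i * y * z * deltaWord x y ^ (m / n) * initialProd x (i + m % n - n) =
      finalProd x (i - 1) * y * z * deltaWord x y ^ (m / n) *
        initialProd x (i + m % n - n - 1)) :
    IsBraidSystem n m (extendSeq hn x y) y z ∧
      wWord m x y z = z * seqProd (extendSeq hn x y) m * y ^ (m / n) := by
  set X := extendSeq hn x y with hX
  set q := m / n with hq
  set r := m % n with hr
  have hrn : r < n := Nat.mod_lt m (Nat.pos_of_ne_zero hn)
  have hmqr : n * q + r = m := Nat.div_add_mod m n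
  have hδ : deltaWord x y = seqProd X n * y := by
    rw [deltaWord, hX, seqProd_extendSeq hn x y le_rfl]
  have hcomm : Commute (seqProd X n * y) z := by
    rw [hX, seqProd_extendSeq hn x y le_rfl]
    exact h1.trans (mul_assoc _ _ _)
  have hshift := extendSeq_shift hn x y
  rw [← hX] at hshift
  have hyP (j : ℕ) : y * seqProd X j = seqProd (fun l => X (n + l)) j * y :=
    seqProd_semiconj (fun i => by rw [hshift, add_comm]) j
  have hPy (j : ℕ) : seqProd X n * y * seqProd X j = seqProd X (n + j) * y := by
    rw [mul_assoc, hyP, seqProd_add, mul_assoc]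
  have hδpow (j i : ℕ) : (seqProd X n * y) ^ j * seqProd X i = seqProd X (n * j + i) * y ^ j := by
    induction j generalizing i with
    | zero => simp
    | succ j ih =>
      rw [pow_succ, mul_assoc, hPy, ← mul_assoc, ih, mul_assoc, ← pow_succ]
      congr 2; ring
  obtain ⟨w, hw⟩ : ∃ w, w = wWord m x y z := ⟨_, rfl⟩
  have hw' : w = z * deltaWord x y ^ q * seqProd X r := by
    rw [hw, wWord, hX, seqProd_extendSeq hn x y hrn.le]
  have hwv : w = z * seqProd X m * y ^ q := by
    rw [hw', hδ, mul_assoc, hδpow, hmqr, mul_assoc]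
  -- With P_i = X_0⋯X_{i-1}, the relations say that P_i⁻¹ z δ^q P_{i+r} does not depend on i ≤ n; at
  -- i = 0 it is w.
  have hstep (i : ℕ) (hi : i ≤ n) :
      seqProd X i * w = z * deltaWord x y ^ q * seqProd X (i + r) := by
    induction i with
    | zero => simp [seqProd, hw']
    | succ i ih =>
      have ih := ih (by omega)
      suffices hE : (seqProd X (i + 1))⁻¹ * (z * deltaWord x y ^ q * seqProd X (i + 1 + r)) =
          (seqProd X i)⁻¹ * (z * deltaWord x y ^ q * seqProd X (i + r)) by
        rw [← ih, inv_mul_cancel_left, inv_mul_eq_iff_eq_mul] at hE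
        exact hE.symm
      rcases le_or_gt (i + 1) (n - r) with hir | hir
      · have hrel := h2 (i + 1) (by omega) hir
        rw [finalProd_eq hn x y hi, finalProd_eq hn x y (show i + 1 - 1 ≤ n by omega),
          ← seqProd_extendSeq hn x y (show i + 1 + r ≤ n by omega),
          ← seqProd_extendSeq hn x y (show i + 1 + r - 1 ≤ n by omega), ← hX, hδ,
          show i + 1 - 1 = i by omega, show i + 1 + r - 1 = i + r by omega] at hrel
        -- As δ = P_n y commutes with z, it is absorbed into δ^{q-1}.
        have hmove (A B : G) : A⁻¹ * seqProd X n * y * z * (seqProd X n * y) ^ ((q : ℤ) - 1) * B =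
            A⁻¹ * (z * deltaWord x y ^ q * B) := by
          calc _ = A⁻¹ * (seqProd X n * y * z) * (seqProd X n * y) ^ ((q : ℤ) - 1) * B := by group
            _ = A⁻¹ * (z * ((seqProd X n * y) ^ (1 + ((q : ℤ) - 1)) * B)) := by
              rw [hcomm.eq, zpow_add, zpow_one]; simp only [mul_assoc]
            _ = _ := by
              rw [add_sub_cancel, zpow_natCast, hδ, mul_assoc z]
        rwa [hmove, hmove] at hrel
      · have hrel := h3 (i + 1) (by omega) hi
        rw [finalProd_eq hn x y hi, finalProd_eq hn x y (show i + 1 - 1 ≤ n by omega),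
          ← seqProd_extendSeq hn x y (show i + 1 + r - n ≤ n by omega),
          ← seqProd_extendSeq hn x y (show i + 1 + r - n - 1 ≤ n by omega), ← hX, hδ,
          show i + 1 - 1 = i by omega] at hrel
        -- Here the absorbed δ is moved to the right instead: δ P_j = P_{n+j} y, and the final y
        -- cancels from both sides.
        have hmove (A : G) (j : ℕ) :
            A⁻¹ * seqProd X n * y * z * (seqProd X n * y) ^ q * seqProd X j =
            A⁻¹ * (z * deltaWord x y ^ q * seqProd X (n + j)) * y := by
          calc _ = A⁻¹ * (seqProd X n * y * z) * (seqProd X n * y) ^ q * seqProd X j := by group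
            _ = A⁻¹ * (z * ((seqProd X n * y) * (seqProd X n * y) ^ q * seqProd X j)) := by
              rw [hcomm.eq]; simp only [mul_assoc]
            _ = A⁻¹ * (z * ((seqProd X n * y) ^ q * (seqProd X n * y * seqProd X j))) := by
              rw [← pow_succ', pow_succ]; simp only [mul_assoc]
            _ = _ := by rw [hPy, hδ]; group
        rw [hmove, hmove, show n + (i + 1 + r - n) = i + 1 + r by omega,
          show n + (i + 1 + r - n - 1) = i + r by omega] at hrel
        exact mul_right_cancel hrel
  -- This is the case i = n of `hstep`, multiplied by y on the right.
  have hwy : Commute w y := by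
    have h := hstep n le_rfl
    have h' : seqProd X n * w * y = seqProd X n * (y * w) := by
      calc _ = z * deltaWord x y ^ q * (seqProd X (n + r) * y) := by rw [h]; group
        _ = z * (deltaWord x y ^ q * deltaWord x y) * seqProd X r := by rw [← hPy, hδ]; group
        _ = (z * (seqProd X n * y)) * deltaWord x y ^ q * seqProd X r := by
          rw [← pow_succ, pow_succ', hδ]; simp only [mul_assoc]
        _ = _ := by rw [← hcomm.eq, hw']; group
    rw [mul_assoc] at h'
    exact mul_left_cancel h'
  have hwX_lt (i : ℕ) (hi : i < n) : w * X (i + r) = X i * w := by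
    have a1 := hstep i hi.le
    have a2 := hstep (i + 1) hi
    rw [show i + 1 + r = (i + r) + 1 by ring, seqProd, seqProd, ← mul_assoc, ← a1, mul_assoc,
      mul_assoc] at a2
    exact (mul_left_cancel a2).symm
  have hwX (i : ℕ) : w * X (i + r) = X i * w := by
    induction i using Nat.strong_induction_on with
    | _ i ih =>
      rcases lt_or_ge i n with hi | hi
      · exact hwX_lt i hi
      · obtain ⟨l, rfl⟩ : ∃ l, i = l + n := ⟨i - n, by omega⟩
        have h := ih l (by omega)
        apply mul_right_cancel (b := y)
        calc w * X (l + n + r) * y = w * (X (l + r + n) * y) := by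
              rw [mul_assoc, show l + n + r = l + r + n by ring]
          _ = w * y * X (l + r) := by rw [← hshift, mul_assoc]
          _ = y * (w * X (l + r)) := by rw [hwy.eq, mul_assoc]
          _ = y * X l * w := by rw [h, mul_assoc]
          _ = X (l + n) * w * y := by rw [hshift, mul_assoc, mul_assoc, hwy.eq]
  -- Conjugation by w lowers indices by r and by y^{-q} lowers them by qn, for a total of m.
  have hv : z * seqProd X m = w * (y ^ q)⁻¹ := by rw [hwv, mul_inv_cancel_right]
  refine ⟨⟨hshift, fun i => ?_, ?_, hcomm⟩, by rw [← hw, hwv]⟩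
  · rw [hv]
    have h := pow_mul_eq_of_shift hshift q (i + r)
    rw [show i + m = i + r + q * n by rw [← hmqr]; ring]
    calc _ = w * ((y ^ q)⁻¹ * (X (i + r + q * n) * y ^ q)) * (y ^ q)⁻¹ := by group
      _ = _ := by rw [← h, inv_mul_cancel_left, hwX]; group
  · rw [hv]
    exact hwy.symm.mul_right ((Commute.refl y).pow_right q).inv_right

/-- With w = v y^q and v, y commuting, the exponent of v is (n - r) + r = n and that of y is q(n -
r) + (q + 1)r = m. -/
theorem garsideWord_eq (h : IsBraidSystem n m (extendSeq hn x y) y z)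
    (hw : wWord m x y z = z * seqProd (extendSeq hn x y) m * y ^ (m / n)) :
    garsideWord m x y z = (z * seqProd (extendSeq hn x y) m) ^ n * y ^ m := by
  have hr : m % n < n := Nat.mod_lt m (Nat.pos_of_ne_zero hn)
  have c1 : Commute (z * seqProd (extendSeq hn x y) m) y := h.comm_y.symm
  rw [garsideWord, hw]
  set v := z * seqProd (extendSeq hn x y) m
  rw [mul_assoc v, ← pow_succ, (c1.pow_right _).mul_pow, (c1.pow_right _).mul_pow, ← pow_mul,
    ← pow_mul]
  calc _ = v ^ (n - m % n) * (y ^ (m / n * (n - m % n)) * v ^ (m % n)) *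
        y ^ ((m / n + 1) * (m % n)) := by group
    _ = v ^ (n - m % n + m % n) * y ^ (m / n * (n - m % n) + (m / n + 1) * (m % n)) := by
      rw [← ((c1.pow_left _).pow_right _).eq, pow_add, pow_add]; group
    _ = _ := by
      rw [Nat.sub_add_cancel hr.le]
      congr 2
      rw [add_mul, ← add_assoc, ← mul_add, Nat.sub_add_cancel hr.le, one_mul, mul_comm,
        Nat.div_add_mod]

end Relations

end BraidSystem

/-! ### The braid group and its Garside element -/

section BraidGroup

variable (k b n c m : ℕ)

/-- The sequence of conjugates of the generators `x_1, …, x_n` of the braid group. -/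
def Braid.X (hn : n ≠ 0) : ℕ → Braid b n c m := extendSeq hn (Braid.x b n c m) (Braid.y b n c m)

variable {k b n c m}

theorem Braid.isBraidSystem_and_wWord (hn : n ≠ 0) :
    IsBraidSystem n m (Braid.X b n c m hn) (Braid.y b n c m) (Braid.z b n c m) ∧
      wWord m (Braid.x b n c m) (Braid.y b n c m) (Braid.z b n c m) =
        Braid.z b n c m * seqProd (Braid.X b n c m hn) m * Braid.y b n c m ^ (m / n) := by
  let F := PresentedGroup.mk (braidRelators b n c m)
  have hI (j : ℕ) : initialProd (Braid.x b n c m) j =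
      F (initialProd (fun i => FreeGroup.of (BraidGen.x i)) j) := (map_initialProd F _ j).symm
  have hE (j : ℕ) : finalProd (Braid.x b n c m) j =
      F (finalProd (fun i => FreeGroup.of (BraidGen.x i)) j) := (map_finalProd F _ j).symm
  have hy : Braid.y b n c m = F (FreeGroup.of BraidGen.y) := rfl
  have hz : Braid.z b n c m = F (FreeGroup.of BraidGen.z) := rfl
  have hδ : deltaWord (Braid.x b n c m) (Braid.y b n c m) =
      F (deltaWord (fun i => FreeGroup.of (BraidGen.x i)) (FreeGroup.of BraidGen.y)) := by
    rw [deltaWord, hI, hy, ← map_mul]; rfl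
  refine isBraidSystem_extendSeq hn ?_ (fun i h1 h2 => ?_) (fun i h1 h2 => ?_)
  · rw [hI, hy, hz]
    simp only [← map_mul]
    apply PresentedGroup.mk_eq_mk_of_mul_inv_mem
    exact Or.inl (Or.inl (Or.inl (Or.inl rfl)))
  · rw [hI, hI, hE, hE, hδ, hy, hz]
    simp only [← map_zpow, ← map_mul]
    apply PresentedGroup.mk_eq_mk_of_mul_inv_mem
    exact Or.inl (Or.inl (Or.inl (Or.inr ⟨i, h1, h2, rfl⟩)))
  · rw [hI, hI, hE, hE, hδ, hy, hz]
    simp only [← map_pow, ← map_mul]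
    apply PresentedGroup.mk_eq_mk_of_mul_inv_mem
    exact Or.inl (Or.inl (Or.inr ⟨i, h1, h2, rfl⟩))

theorem Braid.isBraidSystem (hn : n ≠ 0) :
    IsBraidSystem n m (Braid.X b n c m hn) (Braid.y b n c m) (Braid.z b n c m) :=
  (Braid.isBraidSystem_and_wWord hn).1

theorem Braid.y_eq_one (hb : b = 1) : Braid.y b n c m = 1 :=
  PresentedGroup.one_of_mem (rels := braidRelators b n c m) (x := FreeGroup.of BraidGen.y)
    (Or.inl (Or.inr ⟨hb, rfl⟩))

theorem Braid.z_eq_one (hc : c = 1) : Braid.z b n c m = 1 :=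
  PresentedGroup.one_of_mem (rels := braidRelators b n c m) (x := FreeGroup.of BraidGen.z)
    (Or.inr ⟨hc, rfl⟩)

theorem Braid.Δ_eq_rotation (hn : n ≠ 0) : Braid.Δ b n c m =
    (Braid.z b n c m * seqProd (Braid.X b n c m hn) m) ^ n * Braid.y b n c m ^ m :=
  garsideWord_eq hn (Braid.isBraidSystem hn) (Braid.isBraidSystem_and_wWord hn).2

theorem Braid.Δ_eq (hn : n ≠ 0) :
    Braid.Δ b n c m = Braid.δ b n c m ^ m * Braid.z b n c m ^ n := by
  rw [Braid.Δ_eq_rotation hn, (Braid.isBraidSystem hn).garside_eq, Braid.δ, deltaWord, Braid.X,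
    seqProd_extendSeq hn _ _ le_rfl]

theorem Braid.X_of_fin (hn : n ≠ 0) (i : Fin n) : Braid.X b n c m hn i = Braid.x b n c m i :=
  extendSeq_of_lt hn _ _ i.isLt

theorem Braid.Δ_mem_center (hn : n ≠ 0) : Braid.Δ b n c m ∈ Subgroup.center (Braid b n c m) := by
  have h : Subgroup.centralizer {Braid.Δ b n c m} = ⊤ := by
    rw [eq_top_iff, ← PresentedGroup.closure_range_of, Subgroup.closure_le]
    rintro _ ⟨i | _ | _, rfl⟩ <;>
      rw [SetLike.mem_coe, Subgroup.mem_centralizer_singleton_iff, Braid.Δ_eq_rotation hn]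
    · have := (Braid.isBraidSystem (b := b) (c := c) (m := m) hn).garside_commute_X i
      rw [Braid.X_of_fin] at this
      exact this.symm
    · exact (Braid.isBraidSystem hn).garside_commute_y.symm
    · exact (Braid.isBraidSystem hn).garside_commute_z.symm
  rw [Subgroup.mem_center_iff]
  intro g
  exact Subgroup.mem_centralizer_singleton_iff.mp (h ▸ Subgroup.mem_top g)

/-- This permits replacing b and c by 0 or 1 in the target J; with 0 the torsion relation on t or u
disappears. -/
theorem braidRelators_congr {b₀ c₀ : ℕ} (hb : b₀ = 1 ↔ b = 1) (hc : c₀ = 1 ↔ c = 1) :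
    braidRelators b₀ n c₀ m = braidRelators b n c m := by
  simp only [braidRelators, hb, hc]

end BraidGroup

/-! ### The homomorphism from the braid group to J -/

section ToJ

variable (k : ℕ) {b n c m b₀ c₀ : ℕ} (hb : b₀ = 1 ↔ b = 1) (hc : c₀ = 1 ↔ c = 1)

/-- The homomorphism from the braid group to `J(k, b₀ n, c₀ m)` that sends `x_i` to
`t^{i-1} s t^{1-i}`, `y` to `t^n` and `z` to `u^m`. -/
def Braid.toJ : Braid b n c m →* J k (b₀ * n) (c₀ * m) :=
  (W k b₀ n c₀ m).subtype.comp (PresentedGroup.toGroup (f := genImage k b₀ n c₀ m) fun g hg =>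
    genImage_relators k b₀ n c₀ m g (by rwa [braidRelators_congr hb hc]))

theorem Braid.toJ_x (i : Fin n) : Braid.toJ k hb hc (Braid.x b n c m i) =
    J.t k (b₀ * n) (c₀ * m) ^ (i : ℕ) * J.s k (b₀ * n) (c₀ * m) *
      (J.t k (b₀ * n) (c₀ * m) ^ (i : ℕ))⁻¹ := by
  rw [Braid.toJ, MonoidHom.comp_apply, Braid.x, PresentedGroup.toGroup.of]; rfl

theorem Braid.toJ_y : Braid.toJ k hb hc (Braid.y b n c m) = J.t k (b₀ * n) (c₀ * m) ^ n := by
  rw [Braid.toJ, MonoidHom.comp_apply, Braid.y, PresentedGroup.toGroup.of]; rfl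

theorem Braid.toJ_z : Braid.toJ k hb hc (Braid.z b n c m) = J.u k (b₀ * n) (c₀ * m) ^ m := by
  rw [Braid.toJ, MonoidHom.comp_apply, Braid.z, PresentedGroup.toGroup.of]; rfl

theorem Braid.toJ_X (hn : n ≠ 0) (i : ℕ) : Braid.toJ k hb hc (Braid.X b n c m hn i) =
    J.t k (b₀ * n) (c₀ * m) ^ i * J.s k (b₀ * n) (c₀ * m) * (J.t k (b₀ * n) (c₀ * m) ^ i)⁻¹ := by
  simp only [Braid.X, extendSeq, map_mul, map_inv, map_pow, Braid.toJ_x, Braid.toJ_y]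
  have h : J.t k (b₀ * n) (c₀ * m) ^ i =
      J.t k (b₀ * n) (c₀ * m) ^ (n * (i / n)) * J.t k (b₀ * n) (c₀ * m) ^ (i % n) := by
    rw [← pow_add, Nat.div_add_mod]
  rw [← pow_mul, h]
  group

theorem Braid.toJ_seqProd (hn : n ≠ 0) (j : ℕ) :
    Braid.toJ k hb hc (seqProd (Braid.X b n c m hn) j) =
      (J.s k (b₀ * n) (c₀ * m) * J.t k (b₀ * n) (c₀ * m)) ^ j *
        (J.t k (b₀ * n) (c₀ * m) ^ j)⁻¹ := by
  rw [map_seqProd, funext (Braid.toJ_X k hb hc hn), seqProd_conj]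

theorem J.commute_z (k n m : ℕ) (g : J k n m) : Commute (J.z k n m) g :=
  (Subgroup.mem_center_iff.mp J.z_mem_center g).symm

theorem J.commute_st_u (k n m : ℕ) : Commute (J.s k n m * J.t k n m) (J.u k n m) := by
  have h : J.s k n m * J.t k n m * J.u k n m = J.u k n m * (J.s k n m * J.t k n m) := by
    rw [← mul_assoc]; exact (J.rel₁ _ _ _).trans (J.rel₂ _ _ _)
  exact h

/-- The image is u^m (st)^m t^{-m}, and u commutes with st. -/
theorem Braid.toJ_rotation (hn : n ≠ 0) :
    Braid.toJ k hb hc (Braid.z b n c m * seqProd (Braid.X b n c m hn) m) =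
      J.z k (b₀ * n) (c₀ * m) ^ m * (J.t k (b₀ * n) (c₀ * m) ^ m)⁻¹ := by
  rw [map_mul, Braid.toJ_z, Braid.toJ_seqProd, ← mul_assoc,
    ← ((J.commute_st_u k (b₀ * n) (c₀ * m)).pow_left m |>.pow_right m).eq,
    ← (J.commute_st_u k (b₀ * n) (c₀ * m)).mul_pow, J.z]

theorem Braid.toJ_Δ (hn : n ≠ 0) :
    Braid.toJ k hb hc (Braid.Δ b n c m) = J.z k (b₀ * n) (c₀ * m) ^ (n * m) := by
  rw [Braid.Δ_eq_rotation hn, map_mul, map_pow, map_pow, Braid.toJ_rotation, Braid.toJ_y,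
    ((J.commute_z k (b₀ * n) (c₀ * m) _).pow_left m).mul_pow, inv_pow, ← pow_mul, ← pow_mul,
    ← pow_mul, mul_comm m n, inv_mul_cancel_right]

/-- A subgroup of `J(k, b₀ n, c₀ m)` containing the image of the braid group and `stu` is
everything. -/
theorem eq_top_of_range_toJ_le (hn : n ≠ 0) (hnm : Nat.Coprime n m)
    {K : Subgroup (J k (b₀ * n) (c₀ * m))} (hK : (Braid.toJ k hb hc).range ≤ K)
    (hz : J.z k (b₀ * n) (c₀ * m) ∈ K) : K = ⊤ := by
  have hs : J.s k (b₀ * n) (c₀ * m) ∈ K := by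
    have := hK ⟨Braid.X b n c m hn 0, rfl⟩
    rw [Braid.toJ_X] at this
    simpa using this
  have htn : J.t k (b₀ * n) (c₀ * m) ^ n ∈ K := by
    have := hK ⟨Braid.y b n c m, rfl⟩
    rwa [Braid.toJ_y] at this
  have htm : J.t k (b₀ * n) (c₀ * m) ^ m ∈ K := by
    have := hK ⟨Braid.z b n c m * seqProd (Braid.X b n c m hn) m, rfl⟩
    rw [Braid.toJ_rotation] at this
    have := K.mul_mem (K.inv_mem this) (K.pow_mem hz m)
    rwa [mul_inv_rev, inv_inv, inv_mul_cancel_right] at this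
  -- Coprimality of n and m recovers t from t^n and t^m.
  have ht : J.t k (b₀ * n) (c₀ * m) ∈ K := by
    have h1 : ((n : ℤ) * n.gcdA m + m * n.gcdB m) = 1 := by
      rw [← Nat.gcd_eq_gcd_ab, hnm]; rfl
    rw [← zpow_one (J.t k (b₀ * n) (c₀ * m)), ← h1, zpow_add, zpow_mul, zpow_mul, zpow_natCast,
      zpow_natCast]
    exact K.mul_mem (K.zpow_mem htn _) (K.zpow_mem htm _)
  refine J.induction_on hs ht ?_
  have := K.mul_mem (K.inv_mem (K.mul_mem hs ht)) hz
  rwa [J.z, inv_mul_cancel_left] at this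

/-- An element commuting with the image of the braid group is central. -/
theorem mem_center_of_commute_toJ (hn : n ≠ 0) (hnm : Nat.Coprime n m)
    {g : J k (b₀ * n) (c₀ * m)} (hg : ∀ x, Commute g (Braid.toJ k hb hc x)) :
    g ∈ Subgroup.center (J k (b₀ * n) (c₀ * m)) := by
  have h : Subgroup.centralizer {g} = ⊤ := by
    refine eq_top_of_range_toJ_le k hb hc hn hnm ?_ ?_
    · rintro _ ⟨x, rfl⟩
      exact Subgroup.mem_centralizer_singleton_iff.mpr (hg x).symm
    · exact Subgroup.mem_centralizer_singleton_iff.mpr (J.commute_z _ _ _ g)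
  rw [Subgroup.mem_center_iff]
  intro x
  exact Subgroup.mem_centralizer_singleton_iff.mp (h ▸ Subgroup.mem_top x)

/-- The image of the braid group is normal. -/
theorem range_toJ_normal (hn : n ≠ 0) (hnm : Nat.Coprime n m) :
    (Braid.toJ k hb hc : Braid b n c m →* J k (b₀ * n) (c₀ * m)).range.Normal := by
  rw [← Subgroup.normalizer_eq_top_iff]
  refine eq_top_of_range_toJ_le k hb hc hn hnm Subgroup.le_normalizer ?_
  exact Subgroup.center_le_normalizer _ J.z_mem_center

end ToJ

/-! ### The center of the braid group -/

section Center

variable {b n c m : ℕ}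

/-- The center of the braid group is generated by the Garside element. -/
theorem center_braid (hbn : 2 ≤ b * n) (hcm : 2 ≤ c * m) (hnm : Nat.Coprime n m) :
    Subgroup.center (Braid b n c m) = Subgroup.zpowers (Braid.Δ b n c m) := by
  have hn : n ≠ 0 := by rintro rfl; simp at hbn
  have hm : m ≠ 0 := by rintro rfl; simp at hcm
  refine le_antisymm (fun g hg => ?_) (Subgroup.zpowers_le.mpr (Braid.Δ_mem_center hn))
  have hΔ : (Subgroup.zpowers (Braid.Δ b n c m)).Normal :=
    ⟨fun x hx g => by
      have hc := (Subgroup.zpowers_le.mpr (Braid.Δ_mem_center hn)) hx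
      rw [Subgroup.mem_center_iff.mp hc g, mul_inv_cancel_right]
      exact hx⟩
  let F : Braid b n c m →* Braid b n c m ⧸ Subgroup.zpowers (Braid.Δ b n c m) :=
    QuotientGroup.mk' _
  have hF (x : Braid b n c m) : F x = 1 ↔ x ∈ Subgroup.zpowers (Braid.Δ b n c m) :=
    QuotientGroup.eq_one_iff x
  have hsys := (Braid.isBraidSystem (b := b) (c := c) (m := m) hn).map F
  have hΔ1 : (F (Braid.z b n c m) * seqProd (fun i => F (Braid.X b n c m hn i)) m) ^ n *
      F (Braid.y b n c m) ^ m = 1 := by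
    rw [← map_seqProd, ← map_mul, ← map_pow, ← map_pow, ← map_mul, ← Braid.Δ_eq_rotation hn, hF]
    exact Subgroup.mem_zpowers _
  obtain ⟨t, hty, htX, htz⟩ := hsys.exists_root hn hm hnm hΔ1
  -- For b ≠ 1 nothing bounds the order of y modulo Δ, so t may satisfy no power relation; b₀ = 0
  -- imposes none. The same applies to c₀ and u.
  obtain ⟨b₀, hb₀, hb01⟩ : ∃ b₀, (b₀ = 1 ↔ b = 1) ∧ (b₀ = 0 ∨ b₀ = 1) := by
    by_cases h : b = 1
    · exact ⟨1, by simp [h], by simp⟩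
    · exact ⟨0, by simp [h], by simp⟩
  obtain ⟨c₀, hc₀, hc01⟩ : ∃ c₀, (c₀ = 1 ↔ c = 1) ∧ (c₀ = 0 ∨ c₀ = 1) := by
    by_cases h : c = 1
    · exact ⟨1, by simp [h], by simp⟩
    · exact ⟨0, by simp [h], by simp⟩
  have ht : t ^ (b₀ * n) = 1 := by
    rw [mul_comm, pow_mul, hty]
    rcases hb01 with h | h
    · rw [h, pow_zero]
    · rw [Braid.y_eq_one (hb₀.mp h), map_one, one_pow]
  have hu : (F (Braid.X b n c m hn 0) * t)⁻¹ ^ (c₀ * m) = 1 := by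
    rw [mul_comm c₀, pow_mul, htz]
    rcases hc01 with h | h
    · rw [h, pow_zero]
    · rw [Braid.z_eq_one (hc₀.mp h), map_one, one_pow]
  let back : J 0 (b₀ * n) (c₀ * m) →* Braid b n c m ⧸ Subgroup.zpowers (Braid.Δ b n c m) :=
    J.lift (F (Braid.X b n c m hn 0)) t (F (Braid.X b n c m hn 0) * t)⁻¹ (pow_zero _) ht hu
      (by group) (by group)
  have bs : back (J.s _ _ _) = F (Braid.X b n c m hn 0) := J.lift_s ..
  have bt : back (J.t _ _ _) = t := J.lift_t ..
  have bu : back (J.u _ _ _) = (F (Braid.X b n c m hn 0) * t)⁻¹ := J.lift_u ..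
  have hcomp : back.comp (Braid.toJ 0 hb₀ hc₀) = F := by
    apply PresentedGroup.ext
    rintro (i | _ | _)
    · change back (Braid.toJ 0 hb₀ hc₀ (Braid.x b n c m i)) = F (Braid.x b n c m i)
      rw [← Braid.X_of_fin hn, Braid.toJ_X, map_mul, map_mul, map_inv, map_pow, bs, bt]
      exact (htX i).symm
    · change back (Braid.toJ 0 hb₀ hc₀ (Braid.y b n c m)) = F (Braid.y b n c m)
      rw [Braid.toJ_y, map_pow, bt, hty]
    · change back (Braid.toJ 0 hb₀ hc₀ (Braid.z b n c m)) = F (Braid.z b n c m)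
      rw [Braid.toJ_z, map_pow, bu, htz]
  have hbn1 : b₀ * n ≠ 1 := by
    rcases hb01 with h | h
    · simp [h]
    · rw [hb₀.mp h] at hbn; rw [h]; omega
  have hcm1 : c₀ * m ≠ 1 := by
    rcases hc01 with h | h
    · simp [h]
    · rw [hc₀.mp h] at hcm; rw [h]; omega
  -- Both being 2 would force b₀ = c₀ = 1 and n = m = 2, against coprimality.
  have hdih : b₀ * n ≠ 2 ∨ c₀ * m ≠ 2 := by
    rcases hb01 with rfl | rfl
    · simp
    rcases hc01 with rfl | rfl
    · simp
    by_contra! h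
    rw [one_mul, one_mul] at h
    rw [h.1, h.2] at hnm
    norm_num at hnm
  have hcenter := center_J_of_not_dihedral (k := 0) (n := b₀ * n) (m := c₀ * m) (by norm_num) hbn1
    hcm1 (by omega)
  have hgc : Braid.toJ 0 hb₀ hc₀ g ∈ Subgroup.center (J 0 (b₀ * n) (c₀ * m)) :=
    mem_center_of_commute_toJ 0 hb₀ hc₀ hn hnm fun x =>
      (show Commute g x from (Subgroup.mem_center_iff.mp hg x).symm).map _
  rw [hcenter] at hgc
  obtain ⟨l, hl⟩ := hgc
  -- The image of g in J is a power of stu, which `back` kills since it sends u to (st)⁻¹.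
  rw [← hF, ← hcomp, MonoidHom.comp_apply, ← hl, map_zpow, J.z, map_mul, map_mul, bs, bt, bu,
    mul_inv_cancel, one_zpow]

/-- Sending s to 1 and t, u to 0 defines a map from J with k = 0 to ℤ, under which Δ goes to nm ≠ 0.
-/
theorem Braid.Δ_zpow_injective (hn : n ≠ 0) (hm : m ≠ 0) :
    Function.Injective fun l : ℤ => Braid.Δ b n c m ^ l := by
  let e : J 0 (b * n) (c * m) →* Multiplicative ℤ :=
    J.lift (Multiplicative.ofAdd 1) 1 1 (pow_zero _) (one_pow _) (one_pow _) (by simp) (by simp)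
  have he : e (J.z _ _ _) = Multiplicative.ofAdd 1 := by
    rw [J.z, map_mul, map_mul, show e (J.s _ _ _) = _ from J.lift_s ..,
      show e (J.t _ _ _) = _ from J.lift_t .., show e (J.u _ _ _) = _ from J.lift_u .., mul_one,
      mul_one]
  intro l l' h
  have h := congrArg (fun x => (e (Braid.toJ 0 Iff.rfl Iff.rfl x)).toAdd) h
  simp only [map_zpow, Braid.toJ_Δ 0 _ _ hn, map_pow, he] at h
  simp only [toAdd_zpow, toAdd_pow, toAdd_ofAdd, smul_eq_mul, nsmul_eq_mul, mul_one] at h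
  exact mul_right_cancel₀ (by exact_mod_cast mul_ne_zero hn hm) h

theorem nonempty_center_braid_mulEquiv (hbn : 2 ≤ b * n) (hcm : 2 ≤ c * m)
    (hnm : Nat.Coprime n m) :
    Nonempty (Subgroup.center (Braid b n c m) ≃* Multiplicative ℤ) := by
  have hn : n ≠ 0 := by rintro rfl; simp at hbn
  have hm : m ≠ 0 := by rintro rfl; simp at hcm
  rw [center_braid hbn hcm hnm]
  exact ⟨((zpowersHom (Braid b n c m) (Braid.Δ b n c m)).ofInjective fun l l' h =>
    Braid.Δ_zpow_injective hn hm h).symm⟩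

end Center

/-! ### Surjectivity of π and the center of H -/

section ReflectionGroup

variable {k b n c m : ℕ}

theorem coe_naturalQuotient (x : Braid b n c m) :
    (naturalQuotient k b n c m x : J k (b * n) (c * m)) = Braid.toJ k Iff.rfl Iff.rfl x := rfl

/-- The image in J is normal and contains s, t^n and u^m, hence contains their normal closure H. -/
theorem naturalQuotient_surjective (hn : n ≠ 0) (hnm : Nat.Coprime n m) :
    Function.Surjective (naturalQuotient k b n c m) := by
  have hnormal := range_toJ_normal k (Iff.refl (b = 1)) (Iff.refl (c = 1)) hn hnm
  have hle : W k b n c m ≤ (Braid.toJ k (Iff.refl (b = 1)) (Iff.refl (c = 1)) :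
      Braid b n c m →* J k (b * n) (c * m)).range := by
    refine Subgroup.normalClosure_le_normal ?_
    rintro _ (rfl | rfl | rfl)
    · exact ⟨Braid.X b n c m hn 0, by rw [Braid.toJ_X]; simp⟩
    · exact ⟨Braid.y b n c m, Braid.toJ_y ..⟩
    · exact ⟨Braid.z b n c m, Braid.toJ_z ..⟩
  rintro ⟨w, hw⟩
  obtain ⟨x, hx⟩ := hle hw
  exact ⟨x, Subtype.ext hx⟩

/-- The map from J to ℤ/n × ℤ/m given by s ↦ 0, t ↦ (1, 0), u ↦ (0, 1) kills H and sends stu to (1,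
1), of order nm by coprimality. -/
theorem dvd_of_z_zpow_mem_W (hnm : Nat.Coprime n m) {l : ℤ}
    (h : J.z k (b * n) (c * m) ^ l ∈ W k b n c m) : ((n * m : ℕ) : ℤ) ∣ l := by
  let e : J k (b * n) (c * m) →* Multiplicative (ZMod n × ZMod m) :=
    J.lift 1 (Multiplicative.ofAdd (1, 0)) (Multiplicative.ofAdd (0, 1)) (one_pow _)
      (by rw [← ofAdd_nsmul]; simp) (by rw [← ofAdd_nsmul]; simp) (by simp) (by simp [mul_comm])
  have es : e (J.s _ _ _) = 1 := J.lift_s ..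
  have et : e (J.t _ _ _) = Multiplicative.ofAdd (1, 0) := J.lift_t ..
  have eu : e (J.u _ _ _) = Multiplicative.ofAdd (0, 1) := J.lift_u ..
  have hle : W k b n c m ≤ e.ker := by
    refine Subgroup.normalClosure_le_normal ?_
    rintro _ (rfl | rfl | rfl) <;> rw [SetLike.mem_coe, MonoidHom.mem_ker, map_pow]
    · rw [es, one_pow]
    · rw [et, ← ofAdd_nsmul]; simp
    · rw [eu, ← ofAdd_nsmul]; simp
  have h1 := MonoidHom.mem_ker.mp (hle h)
  rw [map_zpow, J.z, map_mul, map_mul, es, et, eu, one_mul, ← ofAdd_add, ← ofAdd_zsmul,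
    ofAdd_eq_one, Prod.ext_iff] at h1
  simp only [Prod.mk_add_mk, add_zero, zero_add, Prod.smul_mk, zsmul_eq_mul, mul_one, Prod.fst_zero,
    Prod.snd_zero, ZMod.intCast_zmod_eq_zero_iff_dvd] at h1
  push_cast
  exact IsCoprime.mul_dvd (Nat.isCoprime_iff_coprime.mpr hnm) h1.1 h1.2

/-- A central element of H commutes with the image of the braid group, so it is central in J and
equals (stu)^l; membership in H gives nm ∣ l, and π(Δ) = (stu)^{nm}. -/
theorem center_W_le (hk : 2 ≤ k) (hbn : 2 ≤ b * n) (hcm : 2 ≤ c * m) (hnm : Nat.Coprime n m) :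
    Subgroup.center (W k b n c m) ≤
      Subgroup.zpowers (naturalQuotient k b n c m (Braid.Δ b n c m)) := by
  have hn : n ≠ 0 := by rintro rfl; simp at hbn
  rintro ⟨g, hgW⟩ hg
  have hgc : g ∈ Subgroup.center (J k (b * n) (c * m)) :=
    mem_center_of_commute_toJ k (Iff.refl (b = 1)) (Iff.refl (c = 1)) hn hnm fun x =>
      (congrArg Subtype.val (Subgroup.mem_center_iff.mp hg (naturalQuotient k b n c m x))).symm
  rw [center_J hk hbn hcm] at hgc
  obtain ⟨l, rfl⟩ := hgc
  obtain ⟨j, rfl⟩ := dvd_of_z_zpow_mem_W hnm hgW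
  refine ⟨j, Subtype.ext ?_⟩
  change ((naturalQuotient k b n c m (Braid.Δ b n c m)) ^ j : J k (b * n) (c * m)) = _
  rw [coe_naturalQuotient, Braid.toJ_Δ k _ _ hn]
  change _ = J.z k (b * n) (c * m) ^ (((n * m : ℕ) : ℤ) * j)
  rw [zpow_mul, zpow_natCast]

end ReflectionGroup

end JReflection

theorem corollary3p28 (k b n c m : ℕ) (hk : 2 ≤ k) (hbn : 2 ≤ b * n) (hcm : 2 ≤ c * m)
    (hnm : Nat.Coprime n m) :
    Subgroup.center (JReflection.Braid b n c m) =
        Subgroup.zpowers (JReflection.Braid.Δ b n c m) ∧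
      JReflection.Braid.Δ b n c m =
        JReflection.Braid.δ b n c m ^ m * JReflection.Braid.z b n c m ^ n ∧
      Nonempty (Subgroup.center (JReflection.Braid b n c m) ≃* Multiplicative ℤ) ∧
      Function.Surjective (JReflection.naturalQuotient k b n c m) ∧
      (Subgroup.center (JReflection.Braid b n c m)).map
          (JReflection.naturalQuotient k b n c m) =
        Subgroup.center (JReflection.W k b n c m) := by
  have hn : n ≠ 0 := by rintro rfl; simp at hbn
  have hsurj := JReflection.naturalQuotient_surjective (k := k) (b := b) (c := c) hn hnm
  refine ⟨JReflection.center_braid hbn hcm hnm, JReflection.Braid.Δ_eq hn,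
    JReflection.nonempty_center_braid_mulEquiv hbn hcm hnm, hsurj, le_antisymm ?_ ?_⟩
  · rintro _ ⟨x, hx, rfl⟩
    rw [Subgroup.mem_center_iff]
    intro w
    obtain ⟨v, rfl⟩ := hsurj w
    rw [← map_mul, ← map_mul, Subgroup.mem_center_iff.mp hx v]
  · refine (JReflection.center_W_le hk hbn hcm hnm).trans ?_
    rw [JReflection.center_braid hbn hcm hnm, MonoidHom.map_zpowers]
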